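/- Let $0<p<1$ and $\rho>1$ be fixed. Let $Z_b$ and $Z_w$ be independent homogeneous Poisson processes on $\mathbb{R}^2$ of intensities $p$ and $1-p$ (the black and the white points), and let $Z=Z_b\cup Z_w$; equivalently, $Z$ is a Poisson process of intensity $1$ each of whose points is coloured black with probability $p$ and white otherwise, independently. The Voronoi cell of $z\in Z$ is $V_Z(z)=\{x\in\mathbb{R}^2 : |x-z|=\inf_{z'\in Z}|x-z'|\}$, where $|\cdot|$ is the Euclidean norm. A point $x\in\mathbb{R}^2$ is black if it lies in $V_Z(z)$ for some $z\in Z_b$. For $a,s>0$ let $f_p(a,s)$ be the probability that the rectangle $[0,as]\times[0,s]$ has a horizontal black crossing, that is, a piecewise-linear path inside the rectangle, from its left-hand side to its right-hand side, all of whose points are black. If $$\liminf_{s\to\infty} f_p(1,s)>0,$$ then $$\limsup_{s\to\infty} f_p(\rho,s)>0,$$ where $s\to\infty$ through the real numbers. -/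

import Mathlib

open Filter MeasureTheory ProbabilityTheory
open scoped NNReal ENNReal

namespace Voronoi

/-- The plane `ℝ²` with its Euclidean metric and Lebesgue measure. -/
abbrev Plane : Type := EuclideanSpace ℝ (Fin 2)

/-- The number of points of the random set `Z` in `B`. -/
noncomputable def count {Ω : Type*} (Z : Ω → Set Plane) (B : Set Plane) (ω : Ω) : ℕ∞ :=
  (Z ω ∩ B).encard

/-- `Z` is a homogeneous Poisson process of intensity `r` on `ℝ²`, as a random locally finite
set: the number of points in a Borel set of area `a < ∞` has the Poisson distribution with mean
`r a`, and the numbers of points in disjoint Borel sets are independent. -/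
structure IsPoissonProcess {Ω : Type*} [MeasurableSpace Ω] (μ : Measure Ω)
    (Z : Ω → Set Plane) (r : ℝ≥0) : Prop where
  locallyFinite : ∀ᵐ ω ∂μ, ∀ B : Set Plane, Bornology.IsBounded B → (Z ω ∩ B).Finite
  measurable_count : ∀ B : Set Plane, MeasurableSet B → Measurable (count Z B)
  law_count : ∀ B : Set Plane, MeasurableSet B → volume B ≠ ∞ →
    μ.map (count Z B) =
      (poissonMeasure (r * (volume B).toNNReal)).map (fun n : ℕ => (n : ℕ∞))
  indep_count : ∀ (n : ℕ) (B : Fin n → Set Plane), (∀ i, MeasurableSet (B i)) →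
    Pairwise (fun i j => Disjoint (B i) (B j)) → iIndepFun (fun i => count Z (B i)) μ

/-- The σ-algebra on `Ω` generated by the point counts of `Z` in all Borel sets. -/
noncomputable abbrev countSigma {Ω : Type*} (Z : Ω → Set Plane) : MeasurableSpace Ω :=
  ⨆ (B : Set Plane) (_ : MeasurableSet B), MeasurableSpace.comap (count Z B) inferInstance

/-- The coloured Poisson process of random Voronoi percolation with parameter `p`: the black
points `Zb` and the white points `Zw` form independent Poisson processes of intensities `p`
and `1 - p`. -/
structure IsColouredPoisson {Ω : Type*} [MeasurableSpace Ω] (μ : Measure Ω)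
    (Zb Zw : Ω → Set Plane) (p : ℝ) : Prop where
  black : IsPoissonProcess μ Zb p.toNNReal
  white : IsPoissonProcess μ Zw (1 - p).toNNReal
  indep : Indep (countSigma Zb) (countSigma Zw) μ

/-- The Voronoi cell of `z` with respect to `Z` (used for `z ∈ Z`). -/
def cell (Z : Set Plane) (z : Plane) : Set Plane :=
  {x | dist x z = ⨅ z' : Z, dist x (z' : Plane)}

/-- The set of black points of the plane, that is, the union of the Voronoi cells (with respect
to all points) of the black points. A point on the boundary of two cells may also be white. -/
def blackRegion (Zb Zw : Set Plane) : Set Plane :=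
  ⋃ z ∈ Zb, cell (Zb ∪ Zw) z

/-- The rectangle `[0, a] × [0, b]`. -/
def rect (a b : ℝ) : Set Plane :=
  {x | x 0 ∈ Set.Icc 0 a ∧ x 1 ∈ Set.Icc 0 b}

/-- There is a piecewise linear path inside `[0, a] × [0, b]`, with successive vertices
`v 0, …, v n`, from the left-hand side to the right-hand side, all of whose points lie in `A`. -/
def HasHorizontalCrossing (A : Set Plane) (a b : ℝ) : Prop :=
  ∃ (n : ℕ) (v : ℕ → Plane), v 0 ∈ rect a b ∧ v 0 0 = 0 ∧ v n ∈ rect a b ∧ v n 0 = a ∧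
    ∀ i < n, segment ℝ (v i) (v (i + 1)) ⊆ rect a b ∩ A

/-- `f(ρ, s)`: the probability that `[0, ρ s] × [0, s]` has a horizontal black crossing. -/
noncomputable def crossingProb {Ω : Type*} [MeasurableSpace Ω] (μ : Measure Ω)
    (Zb Zw : Ω → Set Plane) (ρ s : ℝ) : ℝ≥0∞ :=
  μ {ω | HasHorizontalCrossing (blackRegion (Zb ω) (Zw ω)) (ρ * s) s}

end Voronoi

/-!
Why a bound on crossings of squares gives crossings of long rectangles at infinitely many scales.
The only probabilistic inputs are the symmetries of the plane and Harris' inequality; no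
asymptotic independence is needed, since only a `limsup` is claimed.

*Topology.* Two planar paths that have to meet for topological reasons do so because otherwise
the difference `f s - g t` would have a continuous logarithm on the square of parameters, while
its argument changes by `-2π` along the boundary (`exists_eq_of_crossing`,
`exists_eq_of_enclosed_end`, `exists_eq_of_interlaced`).

*Probability.* The existence of a black path inside a compact convex set between two closed sets
is a closed increasing property of the configuration (`closedIncreasing_conn`): inside a compact
set the black region is a finite union of convex pieces of Voronoi cells, so if no black path
exists, then the reachable and the unreachable pieces have disjoint neighbourhoods, and no
configuration close enough to the given one has a black path either. The indicator of such a
property is therefore almost surely the limit of increasing functions of the finitely many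
occupied cells of finer and finer partitions. The cells are occupied independently, with
probabilities given by the intensities, which yields measurability, positive association
(`IsColouredPoisson.measure_mul_le_measure_and`, from the finite FKG inequality) and invariance
under isometries (`IsColouredPoisson.connProb_preimage_le`).

*Gluing, after Tassion.* Let `c` bound the crossing probabilities of large squares from below. For
the square `[-h, h]²` let `threshold h` be the least `a` such that the left-hand side is joined to
`{h} × [0, a]` with probability at least `c / 4`. Below the threshold, the left-hand side is
joined to `{h} × [a, h]` with probability at least `c / 4`; combining reflections of such paths
with a vertical crossing gives clusters that enclose the part `[-a, a]` of the two vertical sides.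
If the threshold exceeds `2h / 3`, two such clusters in overlapping squares interlace and form a
long crossing (`Conn.stack`). Otherwise, if moreover the threshold at `h` vanishes or is less
than twice the threshold at `2h / 3`, the paths ending in `{h} × [0, threshold h]` can be shifted so as to
end inside the part of the side enclosed by a cluster in the smaller square; with their mirror
images they form a long crossing (`Conn.bridge`). One of the two situations occurs at arbitrarily
large scales, because otherwise the threshold would double whenever the
scale grows by the factor `3 / 2`, and exceed the scale
(`exists_eq_zero_or_lt_two_mul`). Rectangles of ratio `4 : 3` and squares are then chained
together (`Conn.extend`).
-/

namespace Voronoi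

/-! ### Paths in the plane that have to meet -/

/-- While `u * exp L` stays in the closed right half-plane, the principal argument of `u * exp L`
follows the continuous argument `Im L`. -/
lemma im_sub_im_eq_arg_sub_arg {L : ℝ → ℂ} (hL : Continuous L) {u : ℂ} (hu : u ≠ 0)
    (h : ∀ t, 0 ≤ (u * Complex.exp (L t)).re) :
    (L 1).im - (L 0).im
      = (u * Complex.exp (L 1)).arg - (u * Complex.exp (L 0)).arg := by
  have hne : ∀ t, u * Complex.exp (L t) ≠ 0 := fun t => mul_ne_zero hu (Complex.exp_ne_zero _)
  have hslit : ∀ t, u * Complex.exp (L t) ∈ Complex.slitPlane := by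
    intro t
    rw [Complex.mem_slitPlane_iff]
    by_contra hcon
    push Not at hcon
    exact hne t (Complex.ext (le_antisymm hcon.1 (h t)) hcon.2)
  let D : ℝ → ℂ := fun t => L t + Complex.log u - Complex.log (u * Complex.exp (L t))
  have hD : Continuous D := by
    refine (hL.add continuous_const).sub ?_
    exact Continuous.clog (continuous_const.mul (Complex.continuous_exp.comp hL)) hslit
  have hexp : ∀ t, Complex.exp (D t) = 1 := by
    intro t
    simp only [D]
    rw [Complex.exp_sub, Complex.exp_add, Complex.exp_log hu, Complex.exp_log (hne t), mul_comm,
      div_self (hne t)]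
  let r : ℝ → ℝ := fun t => (D t).im / (2 * Real.pi)
  have hr : Continuous r := (Complex.continuous_im.comp hD).div_const _
  have hrange : ∀ t, r t ∈ Set.range ((↑) : ℤ → ℝ) := by
    intro t
    obtain ⟨n, hn⟩ := Complex.exp_eq_one_iff.1 (hexp t)
    refine ⟨n, ?_⟩
    have hpi := Real.pi_ne_zero
    simp [r, hn]
  have hdisc : IsDiscrete (Set.range ((↑) : ℤ → ℝ)) := by
    rw [isDiscrete_iff_discreteTopology]
    exact
      (Int.isClosedEmbedding_coe_real.isEmbedding.toHomeomorph.symm.isEmbedding).discreteTopology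
  have hconst : r 0 = r 1 := isPreconnected_univ.constant_of_mapsTo hdisc hr.continuousOn
    (fun t _ => hrange t) (Set.mem_univ _) (Set.mem_univ _)
  have hpi := Real.pi_pos
  have him : (D 0).im = (D 1).im := by
    have := (div_left_inj' (c := 2 * Real.pi) (by positivity)).1 hconst
    exact this
  simp only [D, Complex.sub_im, Complex.add_im, Complex.log_im] at him
  linarith

/-- Two paths `f` and `g` that never meet: the difference `f s - g t` has a continuous logarithm
on the square of parameters. -/
lemma exists_continuous_log_sub {f g : ℝ → ℂ} (hf : Continuous f) (hg : Continuous g)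
    (hne : ∀ s t, f s ≠ g t) :
    ∃ G : ℝ × ℝ → ℂ, Continuous G ∧ ∀ s t, Complex.exp (G (s, t)) = f s - g t := by
  have h0 : f 0 - g 0 ≠ 0 := sub_ne_zero.2 (hne 0 0)
  obtain ⟨G, ⟨-, hG⟩, -⟩ := Complex.isCoveringMapOn_exp.existsUnique_continuousMap_lifts
    (A := ℝ × ℝ) ⟨fun z => f z.1 - g z.2, by fun_prop⟩ (a₀ := (0, 0)) (Complex.exp_log h0)
    (fun z => by simpa using sub_ne_zero.2 (hne z.1 z.2))
  exact ⟨G, G.continuous, fun s t => congr_fun hG (s, t)⟩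

/-- The sum of the changes of argument of `f s - g t` along the sides of the unit square of
parameters vanishes; each side may be measured in its own half-plane, selected by `u₁, …, u₄`. -/
lemma arg_change_around_square {f g : ℝ → ℂ} (hf : Continuous f) (hg : Continuous g)
    (hne : ∀ s t, f s ≠ g t) {u₁ u₂ u₃ u₄ : ℂ}
    (hu₁ : u₁ ≠ 0) (hu₂ : u₂ ≠ 0) (hu₃ : u₃ ≠ 0) (hu₄ : u₄ ≠ 0)
    (h₁ : ∀ s, 0 ≤ (u₁ * (f s - g 0)).re) (h₂ : ∀ t, 0 ≤ (u₂ * (f 1 - g t)).re)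
    (h₃ : ∀ s, 0 ≤ (u₃ * (f s - g 1)).re) (h₄ : ∀ t, 0 ≤ (u₄ * (f 0 - g t)).re) :
    ((u₁ * (f 1 - g 0)).arg - (u₁ * (f 0 - g 0)).arg)
      + ((u₂ * (f 1 - g 1)).arg - (u₂ * (f 1 - g 0)).arg)
    = ((u₄ * (f 0 - g 1)).arg - (u₄ * (f 0 - g 0)).arg)
      + ((u₃ * (f 1 - g 1)).arg - (u₃ * (f 0 - g 1)).arg) := by
  obtain ⟨G, hG, hexp⟩ := exists_continuous_log_sub hf hg hne
  have e₁ := im_sub_im_eq_arg_sub_arg (L := fun s => G (s, 0)) (by fun_prop) hu₁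
    (by simpa [hexp] using h₁)
  have e₂ := im_sub_im_eq_arg_sub_arg (L := fun t => G (1, t)) (by fun_prop) hu₂
    (by simpa [hexp] using h₂)
  have e₃ := im_sub_im_eq_arg_sub_arg (L := fun s => G (s, 1)) (by fun_prop) hu₃
    (by simpa [hexp] using h₃)
  have e₄ := im_sub_im_eq_arg_sub_arg (L := fun t => G (0, t)) (by fun_prop) hu₄
    (by simpa [hexp] using h₄)
  simp only [hexp] at e₁ e₂ e₃ e₄
  linarith

lemma arg_neg_I_mul_of_quadrant {z : ℂ} (hz : z ≠ 0) (hre : 0 ≤ z.re) (him : 0 ≤ z.im) :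
    (-Complex.I * z).arg = z.arg - Real.pi / 2 := by
  have h1 : 0 ≤ z.arg := Complex.arg_nonneg_iff.2 him
  have h2 : z.arg ≤ Real.pi / 2 :=
    (abs_le.1 (Complex.abs_arg_le_pi_div_two_iff.2 hre)).2
  have hpi := Real.pi_pos
  rw [Complex.arg_mul (by simp) hz]
  · rw [Complex.arg_neg_I]; ring
  · rw [Complex.arg_neg_I]
    constructor <;> linarith

/-- A path from the left to the right of a second path meets it, if that second path goes from
below to above the first one. -/
lemma exists_eq_of_crossing {f g : ℝ → ℂ} (hf : Continuous f) (hg : Continuous g)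
    (hl : ∀ t, (f 0).re ≤ (g t).re) (hr : ∀ t, (g t).re ≤ (f 1).re)
    (hb : ∀ s, (g 0).im ≤ (f s).im) (ht : ∀ s, (f s).im ≤ (g 1).im) :
    ∃ s t, f s = g t := by
  by_contra hcon
  push Not at hcon
  have key := arg_change_around_square hf hg hcon (u₁ := -Complex.I) (u₂ := 1) (u₃ := Complex.I)
    (u₄ := -1) (by simp) (by simp) (by simp) (by simp)
    (fun s => by simpa using hb s) (fun t => by simpa using hr t)
    (fun s => by simpa using ht s) (fun t => by simpa using hl t)
  have c10 := arg_neg_I_mul_of_quadrant (sub_ne_zero.2 (hcon 1 0))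
    (by simpa using hr 0) (by simpa using hb 1)
  have c11 := arg_neg_I_mul_of_quadrant (z := Complex.I * (f 1 - g 1))
    (mul_ne_zero Complex.I_ne_zero (sub_ne_zero.2 (hcon 1 1)))
    (by simpa using ht 1) (by simpa using hr 1)
  have c01 := arg_neg_I_mul_of_quadrant (z := -1 * (f 0 - g 1))
    (mul_ne_zero (by simp) (sub_ne_zero.2 (hcon 0 1)))
    (by simpa using hl 1) (by simpa using ht 0)
  have c00 := arg_neg_I_mul_of_quadrant (z := -Complex.I * (f 0 - g 0))
    (mul_ne_zero (by simp) (sub_ne_zero.2 (hcon 0 0)))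
    (by simpa using hb 0) (by simpa using hl 0)
  have e11 : -Complex.I * (Complex.I * (f 1 - g 1)) = 1 * (f 1 - g 1) := by
    rw [← mul_assoc]; simp
  have e01 : -Complex.I * (-1 * (f 0 - g 1)) = Complex.I * (f 0 - g 1) := by ring
  have e00 : -Complex.I * (-Complex.I * (f 0 - g 0)) = -1 * (f 0 - g 0) := by
    rw [← mul_assoc]; simp
  rw [e11] at c11
  rw [e01] at c01
  rw [e00] at c00
  rw [one_mul (f 1 - g 0)] at key
  have hpi := Real.pi_pos
  linarith

/-- A path `f` ending on a vertical line meets a path `g` on the same side of the line whose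
endpoints lie on the line below and above the end of `f`, if `f` starts to the left of `g`. -/
lemma exists_eq_of_enclosed_end {f g : ℝ → ℂ} (hf : Continuous f) (hg : Continuous g)
    (hl : ∀ t, (f 0).re ≤ (g t).re) (hr : ∀ t, (g t).re ≤ (f 1).re)
    (hb : ∀ s, (f s).re ≤ (g 0).re) (ht : ∀ s, (f s).re ≤ (g 1).re)
    (hb' : (g 0).im ≤ (f 1).im) (ht' : (f 1).im ≤ (g 1).im) :
    ∃ s t, f s = g t := by
  by_contra hcon
  push Not at hcon
  have key := arg_change_around_square hf hg hcon (u₁ := -1) (u₂ := 1) (u₃ := -1)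
    (u₄ := -1) (by simp) (by simp) (by simp) (by simp)
    (fun s => by simpa using hb s) (fun t => by simpa using hr t)
    (fun s => by simpa using ht s) (fun t => by simpa using hl t)
  have r0 : (f 1).re = (g 0).re := le_antisymm (hb 1) (hr 0)
  have r1 : (f 1).re = (g 1).re := le_antisymm (ht 1) (hr 1)
  have i0 : (g 0).im < (f 1).im := lt_of_le_of_ne hb' fun h => hcon 1 0 (Complex.ext r0 h.symm)
  have i1 : (f 1).im < (g 1).im := lt_of_le_of_ne ht' fun h => hcon 1 1 (Complex.ext r1 h)
  have a1 : (-1 * (f 1 - g 0)).arg = -(Real.pi / 2) :=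
    Complex.arg_eq_neg_pi_div_two_iff.2 ⟨by simp [r0], by simpa using i0⟩
  have a2 : (1 * (f 1 - g 0)).arg = Real.pi / 2 :=
    Complex.arg_eq_pi_div_two_iff.2 ⟨by simp [r0], by simpa using i0⟩
  have a3 : (1 * (f 1 - g 1)).arg = -(Real.pi / 2) :=
    Complex.arg_eq_neg_pi_div_two_iff.2 ⟨by simp [r1], by simpa using i1⟩
  have a4 : (-1 * (f 1 - g 1)).arg = Real.pi / 2 :=
    Complex.arg_eq_pi_div_two_iff.2 ⟨by simp [r1], by simpa using i1⟩
  rw [a1, a2, a3, a4] at key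
  have hpi := Real.pi_pos
  linarith

/-- Two paths on the left of a vertical line meet, if their endpoints lie on the line and
interlace there. -/
lemma exists_eq_of_interlaced {f g : ℝ → ℂ} (hf : Continuous f) (hg : Continuous g)
    (hl : ∀ t, (g t).re ≤ (f 0).re) (hr : ∀ t, (g t).re ≤ (f 1).re)
    (hb : ∀ s, (f s).re ≤ (g 0).re) (ht : ∀ s, (f s).re ≤ (g 1).re)
    (h₁ : (f 0).im ≤ (g 0).im) (h₂ : (g 0).im ≤ (f 1).im) (h₃ : (f 1).im ≤ (g 1).im) :
    ∃ s t, f s = g t := by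
  by_contra hcon
  push Not at hcon
  have key := arg_change_around_square hf hg hcon (u₁ := -1) (u₂ := 1) (u₃ := -1)
    (u₄ := 1) (by simp) (by simp) (by simp) (by simp)
    (fun s => by simpa using hb s) (fun t => by simpa using hr t)
    (fun s => by simpa using ht s) (fun t => by simpa using hl t)
  have r00 : (f 0).re = (g 0).re := le_antisymm (hb 0) (hl 0)
  have r01 : (f 0).re = (g 1).re := le_antisymm (ht 0) (hl 1)
  have r10 : (f 1).re = (g 0).re := le_antisymm (hb 1) (hr 0)
  have r11 : (f 1).re = (g 1).re := le_antisymm (ht 1) (hr 1)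
  have i00 : (f 0).im < (g 0).im := lt_of_le_of_ne h₁ fun h => hcon 0 0 (Complex.ext r00 h)
  have i10 : (g 0).im < (f 1).im := lt_of_le_of_ne h₂ fun h => hcon 1 0 (Complex.ext r10 h.symm)
  have i11 : (f 1).im < (g 1).im := lt_of_le_of_ne h₃ fun h => hcon 1 1 (Complex.ext r11 h)
  have i01 : (f 0).im < (g 1).im := i00.trans (i10.trans i11)
  have a1 : (-1 * (f 1 - g 0)).arg = -(Real.pi / 2) :=
    Complex.arg_eq_neg_pi_div_two_iff.2 ⟨by simp [r10], by simpa using i10⟩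
  have a2 : (1 * (f 1 - g 0)).arg = Real.pi / 2 :=
    Complex.arg_eq_pi_div_two_iff.2 ⟨by simp [r10], by simpa using i10⟩
  have a3 : (1 * (f 1 - g 1)).arg = -(Real.pi / 2) :=
    Complex.arg_eq_neg_pi_div_two_iff.2 ⟨by simp [r11], by simpa using i11⟩
  have a4 : (-1 * (f 1 - g 1)).arg = Real.pi / 2 :=
    Complex.arg_eq_pi_div_two_iff.2 ⟨by simp [r11], by simpa using i11⟩
  have a5 : (-1 * (f 0 - g 0)).arg = Real.pi / 2 :=
    Complex.arg_eq_pi_div_two_iff.2 ⟨by simp [r00], by simpa using i00⟩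
  have a6 : (1 * (f 0 - g 0)).arg = -(Real.pi / 2) :=
    Complex.arg_eq_neg_pi_div_two_iff.2 ⟨by simp [r00], by simpa using i00⟩
  have a7 : (1 * (f 0 - g 1)).arg = -(Real.pi / 2) :=
    Complex.arg_eq_neg_pi_div_two_iff.2 ⟨by simp [r01], by simpa using i01⟩
  have a8 : (-1 * (f 0 - g 1)).arg = Real.pi / 2 :=
    Complex.arg_eq_pi_div_two_iff.2 ⟨by simp [r01], by simpa using i01⟩
  rw [a1, a2, a3, a4, a5, a6, a7, a8] at key
  have hpi := Real.pi_pos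
  linarith

/-! ### Piecewise linear paths -/

/-- `x ∈ A` and `y` are the endpoints of a piecewise linear path in `A`. -/
def PLJoined (A : Set Plane) (x y : Plane) : Prop :=
  x ∈ A ∧ Relation.ReflTransGen (fun u v => segment ℝ u v ⊆ A) x y

namespace PLJoined

variable {A B : Set Plane} {x y z : Plane}

lemma left_mem (h : PLJoined A x y) : x ∈ A := h.1

lemma right_mem (h : PLJoined A x y) : y ∈ A := by
  rcases Relation.ReflTransGen.cases_tail h.2 with h' | ⟨c, -, h'⟩
  · exact h' ▸ h.1
  · exact h' (right_mem_segment ℝ c y)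

lemma refl (h : x ∈ A) : PLJoined A x x := ⟨h, .refl⟩

lemma of_segment (h : segment ℝ x y ⊆ A) : PLJoined A x y :=
  ⟨h (left_mem_segment ℝ x y), .single h⟩

lemma trans (h : PLJoined A x y) (h' : PLJoined A y z) : PLJoined A x z :=
  ⟨h.1, h.2.trans h'.2⟩

lemma symm (h : PLJoined A x y) : PLJoined A y x := by
  refine ⟨h.right_mem, ?_⟩
  refine Relation.ReflTransGen.mono (fun u v huv => ?_) _ _ (Relation.ReflTransGen.swap _ _ h.2)
  rwa [Function.swap, segment_symm] at huv

lemma mono (h : PLJoined A x y) (hAB : A ⊆ B) : PLJoined B x y :=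
  ⟨hAB h.1, Relation.ReflTransGen.mono (fun _ _ huv => Set.Subset.trans huv hAB) _ _ h.2⟩

lemma of_convex (hA : Convex ℝ A) (hx : x ∈ A) (hy : y ∈ A) : PLJoined A x y :=
  of_segment (hA.segment_subset hx hy)

lemma map (g : Plane ≃ᵃⁱ[ℝ] Plane) (h : PLJoined (g ⁻¹' A) x y) : PLJoined A (g x) (g y) := by
  refine ⟨h.1, Relation.ReflTransGen.lift g (fun u v huv => ?_) _ _ h.2⟩
  change segment ℝ (g u) (g v) ⊆ A
  have : segment ℝ (g u) (g v) = g '' segment ℝ u v :=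
    (image_segment ℝ g.toAffineEquiv.toAffineMap u v).symm
  rw [this]
  exact Set.image_subset_iff.2 huv

/-- A piecewise linear path is the trace of a continuous path, every point of which can be
reached from its start by a piecewise linear path. -/
lemma exists_path (h : PLJoined A x y) : ∃ γ : Path x y, ∀ t, PLJoined A x (γ t) := by
  obtain ⟨hx, h⟩ := h
  induction h with
  | refl => exact ⟨Path.refl x, fun t => by simpa using refl hx⟩
  | @tail b c hb hbc ih =>
    obtain ⟨γ, hγ⟩ := ih
    have hxb : PLJoined A x b := ⟨hx, hb⟩
    refine ⟨γ.trans (Path.segment b c), fun t => ?_⟩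
    have ht : (γ.trans (Path.segment b c)) t ∈ Set.range (γ.trans (Path.segment b c)) :=
      Set.mem_range_self t
    rw [Path.trans_range] at ht
    rcases ht with ⟨s, hs⟩ | ⟨s, hs⟩
    · exact hs ▸ hγ s
    · have hmem : (Path.segment b c) s ∈ segment ℝ b c := by
        rw [← Path.range_segment]
        exact Set.mem_range_self s
      rw [← hs]
      exact hxb.trans (of_segment
        (((convex_segment b c).segment_subset (left_mem_segment ℝ b c) hmem).trans hbc))

/-- The continuous path of `exists_path`, in the coordinates `σ x₀ + i x₁`. -/
lemma exists_complex_path (h : PLJoined A x y) (σ : ℝ) :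
    ∃ (γ : ℝ → Plane) (f : ℝ → ℂ), Continuous f ∧ γ 0 = x ∧ γ 1 = y ∧ (∀ t, PLJoined A x (γ t)) ∧
      (∀ t, (f t).re = σ * γ t 0) ∧ ∀ t, (f t).im = γ t 1 := by
  obtain ⟨γ, hγ⟩ := h.exists_path
  refine ⟨γ.extend, fun t => ⟨σ * γ.extend t 0, γ.extend t 1⟩, ?_, by simp, by simp, ?_,
    fun t => rfl, fun t => rfl⟩
  · have hc : Continuous γ.extend := γ.continuous_extend
    have h0 : Continuous fun t => σ * γ.extend t 0 := by fun_prop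
    have h1 : Continuous fun t => γ.extend t 1 := by fun_prop
    have : (fun t => (⟨σ * γ.extend t 0, γ.extend t 1⟩ : ℂ))
        = fun t => ((σ * γ.extend t 0 : ℝ) : ℂ) + ((γ.extend t 1 : ℝ) : ℂ) * Complex.I := by
      funext t
      apply Complex.ext <;> simp
    rw [this]
    fun_prop
  · intro t
    have : γ.extend t ∈ Set.range γ.extend := Set.mem_range_self t
    rw [Path.extend_range] at this
    obtain ⟨s, hs⟩ := this
    exact hs ▸ hγ s

end PLJoined

/-- Equality of points of the plane from equality of the coordinates `σ x₀ + i x₁`. -/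
lemma plane_eq_of_complex_eq {σ : ℝ} (hσ : σ ≠ 0) {a b : Plane} {z w : ℂ} (h : z = w)
    (ha : z.re = σ * a 0) (ha' : z.im = a 1) (hb : w.re = σ * b 0) (hb' : w.im = b 1) :
    a = b := by
  subst h
  ext i
  fin_cases i
  · exact mul_left_cancel₀ hσ (ha.symm.trans hb)
  · exact ha'.symm.trans hb'

/-- A horizontal and a vertical crossing meet. -/
lemma PLJoined.exists_meet_of_crossing {A B : Set Plane} {x x' y y' : Plane}
    (h : PLJoined A x x') (h' : PLJoined B y y')
    (hB : ∀ z ∈ B, x 0 ≤ z 0 ∧ z 0 ≤ x' 0) (hA : ∀ z ∈ A, y 1 ≤ z 1 ∧ z 1 ≤ y' 1) :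
    ∃ z, PLJoined A x z ∧ PLJoined B y z := by
  obtain ⟨γ, f, hf, hγ0, hγ1, hγ, hre, him⟩ := h.exists_complex_path 1
  obtain ⟨δ, g, hg, hδ0, hδ1, hδ, hre', him'⟩ := h'.exists_complex_path 1
  obtain ⟨s, t, hst⟩ := exists_eq_of_crossing hf hg
    (fun t => by rw [hre, hre', hγ0]; simpa using (hB _ (hδ t).right_mem).1)
    (fun t => by rw [hre, hre', hγ1]; simpa using (hB _ (hδ t).right_mem).2)
    (fun s => by rw [him, him', hδ0]; exact (hA _ (hγ s).right_mem).1)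
    (fun s => by rw [him, him', hδ1]; exact (hA _ (hγ s).right_mem).2)
  have : γ s = δ t :=
    plane_eq_of_complex_eq one_ne_zero hst (hre s) (him s) (hre' t) (him' t)
  exact ⟨γ s, hγ s, this ▸ hδ t⟩

/-- A path whose end is enclosed by a path with endpoints on a vertical side meets that path. The
side is on the right for `σ = 1` and on the left for `σ = -1`. -/
lemma PLJoined.exists_meet_of_enclosed_end {A B : Set Plane} {x x' y y' : Plane} {σ : ℝ}
    (hσ : σ ≠ 0) (h : PLJoined A x x') (h' : PLJoined B y y')
    (hB : ∀ z ∈ B, σ * x 0 ≤ σ * z 0 ∧ σ * z 0 ≤ σ * x' 0)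
    (hA : ∀ z ∈ A, σ * z 0 ≤ σ * y 0 ∧ σ * z 0 ≤ σ * y' 0)
    (h₁ : y 1 ≤ x' 1) (h₂ : x' 1 ≤ y' 1) :
    ∃ z, PLJoined A x z ∧ PLJoined B y z := by
  obtain ⟨γ, f, hf, hγ0, hγ1, hγ, hre, him⟩ := h.exists_complex_path σ
  obtain ⟨δ, g, hg, hδ0, hδ1, hδ, hre', him'⟩ := h'.exists_complex_path σ
  obtain ⟨s, t, hst⟩ := exists_eq_of_enclosed_end hf hg
    (fun t => by rw [hre, hre', hγ0]; exact (hB _ (hδ t).right_mem).1)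
    (fun t => by rw [hre, hre', hγ1]; exact (hB _ (hδ t).right_mem).2)
    (fun s => by rw [hre, hre', hδ0]; exact (hA _ (hγ s).right_mem).1)
    (fun s => by rw [hre, hre', hδ1]; exact (hA _ (hγ s).right_mem).2)
    (by rw [him, him', hγ1, hδ0]; exact h₁) (by rw [him, him', hγ1, hδ1]; exact h₂)
  have : γ s = δ t := plane_eq_of_complex_eq hσ hst (hre s) (him s) (hre' t) (him' t)
  exact ⟨γ s, hγ s, this ▸ hδ t⟩

/-- Two paths with interlacing endpoints on the right-hand side of a region meet. -/
lemma PLJoined.exists_meet_of_interlaced {A B : Set Plane} {x x' y y' : Plane}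
    (h : PLJoined A x x') (h' : PLJoined B y y')
    (hB : ∀ z ∈ B, z 0 ≤ x 0 ∧ z 0 ≤ x' 0) (hA : ∀ z ∈ A, z 0 ≤ y 0 ∧ z 0 ≤ y' 0)
    (h₁ : x 1 ≤ y 1) (h₂ : y 1 ≤ x' 1) (h₃ : x' 1 ≤ y' 1) :
    ∃ z, PLJoined A x z ∧ PLJoined B y z := by
  obtain ⟨γ, f, hf, hγ0, hγ1, hγ, hre, him⟩ := h.exists_complex_path 1
  obtain ⟨δ, g, hg, hδ0, hδ1, hδ, hre', him'⟩ := h'.exists_complex_path 1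
  obtain ⟨s, t, hst⟩ := exists_eq_of_interlaced hf hg
    (fun t => by rw [hre, hre', hγ0]; simpa using (hB _ (hδ t).right_mem).1)
    (fun t => by rw [hre, hre', hγ1]; simpa using (hB _ (hδ t).right_mem).2)
    (fun s => by rw [hre, hre', hδ0]; simpa using (hA _ (hγ s).right_mem).1)
    (fun s => by rw [hre, hre', hδ1]; simpa using (hA _ (hγ s).right_mem).2)
    (by rw [him, him', hγ0, hδ0]; exact h₁) (by rw [him, him', hγ1, hδ0]; exact h₂)
    (by rw [him, him', hγ1, hδ1]; exact h₃)
  have : γ s = δ t :=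
    plane_eq_of_complex_eq one_ne_zero hst (hre s) (him s) (hre' t) (him' t)
  exact ⟨γ s, hγ s, this ▸ hδ t⟩

/-- A path from `{f ≤ b}` to `{b ≤ f}` has an initial piece in `{f ≤ b}` that ends on
`{f = b}`. -/
lemma PLJoined.exists_initial_piece {A : Set Plane} {x y : Plane} (f : Plane →ₗ[ℝ] ℝ) {b : ℝ}
    (h : PLJoined A x y) (hx : f x ≤ b) (hy : b ≤ f y) :
    ∃ z, f z = b ∧ PLJoined (A ∩ {w | f w ≤ b}) x z := by
  have hyA := h.right_mem
  have hconv : Convex ℝ {w | f w ≤ b} := convex_halfSpace_le f.isLinear b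
  induction h.2 using Relation.ReflTransGen.head_induction_on with
  | refl => exact ⟨y, le_antisymm hx hy, PLJoined.refl ⟨hyA, hx⟩⟩
  | @head u c huc hcy ih =>
    rcases le_total (f c) b with hc | hc
    · obtain ⟨z, hz, hcz⟩ := ih ⟨huc (right_mem_segment ℝ u c), hcy⟩ hc
      exact ⟨z, hz, (PLJoined.of_segment
        (Set.subset_inter huc (hconv.segment_subset hx hc))).trans hcz⟩
    · have hb : b ∈ f '' segment ℝ u c := by
        have := image_segment ℝ f.toAffineMap u c
        simp only [LinearMap.coe_toAffineMap] at this
        rw [this, segment_eq_Icc (hx.trans hc)]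
        exact ⟨hx, hc⟩
      obtain ⟨z, hz, hzb⟩ := hb
      refine ⟨z, hzb, PLJoined.of_segment (Set.subset_inter ?_ ?_)⟩
      · exact ((convex_segment u c).segment_subset (left_mem_segment ℝ u c) hz).trans huc
      · exact hconv.segment_subset hx hzb.le

/-- A path from `{x i ≤ a}` to `{b ≤ x i}` contains one across the strip `{a ≤ x i ≤ b}`. -/
lemma PLJoined.exists_strip_crossing {A : Set Plane} {x y : Plane} {a b : ℝ} (i : Fin 2)
    (hab : a ≤ b) (h : PLJoined A x y) (hx : x i ≤ a) (hy : b ≤ y i) :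
    ∃ x' y', x' i = a ∧ y' i = b ∧ PLJoined (A ∩ {w | a ≤ w i ∧ w i ≤ b}) x' y' := by
  let f : Plane →ₗ[ℝ] ℝ := (EuclideanSpace.proj i : Plane →L[ℝ] ℝ).toLinearMap
  obtain ⟨y', hy', h₁⟩ := h.exists_initial_piece f (b := b) (hx.trans hab) hy
  obtain ⟨x', hx', h₂⟩ := h₁.symm.exists_initial_piece (-f) (b := -a)
    (by simp [hy', hab]) (by simpa [f] using hx)
  refine ⟨x', y', by simpa [f] using hx', hy', h₂.symm.mono ?_⟩
  rintro w ⟨⟨hwA, hwb⟩, hwa⟩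
  exact ⟨hwA, by simpa [f] using hwa, hwb⟩

lemma hasHorizontalCrossing_iff {A : Set Plane} {a b : ℝ} (ha : a ≠ 0) :
    HasHorizontalCrossing A a b ↔
      ∃ x y, x 0 = 0 ∧ y 0 = a ∧ PLJoined (rect a b ∩ A) x y := by
  constructor
  · rintro ⟨n, v, -, h0, -, hn, hseg⟩
    refine ⟨v 0, v n, h0, hn, ?_, ?_⟩
    · have hpos : 0 < n := by
        rcases Nat.eq_zero_or_pos n with rfl | h
        · exact absurd (hn.symm.trans h0) ha
        · exact h
      exact hseg 0 hpos (left_mem_segment ℝ _ _)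
    · have : ∀ m ≤ n, Relation.ReflTransGen
          (fun u v => segment ℝ u v ⊆ rect a b ∩ A) (v 0) (v m) := by
        intro m
        induction m with
        | zero => exact fun _ => .refl
        | succ m ih => exact fun hm => (ih (by omega)).tail (hseg m (by omega))
      exact this n le_rfl
  · rintro ⟨x, y, hx, hy, h⟩
    have hxm := h.left_mem.1
    have hym := h.right_mem.1
    have key : ∃ (n : ℕ) (v : ℕ → Plane), v 0 = x ∧ v n = y ∧
        ∀ i < n, segment ℝ (v i) (v (i + 1)) ⊆ rect a b ∩ A := by
      clear hym hy
      induction h.2 with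
      | refl => exact ⟨0, fun _ => x, rfl, rfl, fun i hi => absurd hi (Nat.not_lt_zero i)⟩
      | @tail c d hc hcd ih =>
        obtain ⟨n, v, h0, hn, hseg⟩ := ih ⟨h.1, hc⟩
        refine ⟨n + 1, fun i => if i ≤ n then v i else d, by simp [h0], by simp, ?_⟩
        intro i hi
        rcases Nat.lt_succ_iff_lt_or_eq.1 hi with h' | rfl
        · have h'' : i + 1 ≤ n := h'
          simpa [h'.le, h''] using hseg i h'
        · simpa [hn] using hcd
    obtain ⟨n, v, h0, hn, hseg⟩ := key
    exact ⟨n, v, by rwa [h0], by rw [h0, hx], by rwa [hn], by rw [hn, hy], hseg⟩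

/-! ### The black set and connections in it -/

/-- The points having a point of `Yb` at least as close as all points of `Yw`. For locally finite
sets this is `blackRegion Yb Yw`, but it is monotone in `Yb` and `Yw` without assumptions. -/
def blackSet (Yb Yw : Set Plane) : Set Plane :=
  {x | ∃ b ∈ Yb, ∀ w ∈ Yw, dist x b ≤ dist x w}

/-- Every bounded set contains only finitely many points of `Z`. -/
def LocallyFinitePoints (Z : Set Plane) : Prop :=
  ∀ B : Set Plane, Bornology.IsBounded B → (Z ∩ B).Finite

/-- Some piecewise linear black path inside `R` joins `S` to `T`. -/
def Conn (R S T Yb Yw : Set Plane) : Prop :=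
  ∃ x ∈ S, ∃ y ∈ T, PLJoined (R ∩ blackSet Yb Yw) x y

lemma blackSet_mono {Yb Yw Yb' Yw' : Set Plane} (hb : Yb ⊆ Yb') (hw : Yw' ⊆ Yw) :
    blackSet Yb Yw ⊆ blackSet Yb' Yw' :=
  fun _ ⟨b, hbY, h⟩ => ⟨b, hb hbY, fun w hwY => h w (hw hwY)⟩

lemma Conn.mono {R S T R' S' T' Yb Yw : Set Plane} (h : Conn R S T Yb Yw) (hR : R ⊆ R')
    (hS : S ∩ R ⊆ S') (hT : T ∩ R ⊆ T') : Conn R' S' T' Yb Yw := by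
  obtain ⟨x, hx, y, hy, h⟩ := h
  exact ⟨x, hS ⟨hx, h.left_mem.1⟩, y, hT ⟨hy, h.right_mem.1⟩,
    h.mono (Set.inter_subset_inter_left _ hR)⟩

lemma LocallyFinitePoints.exists_nearest {Z : Set Plane} (hZ : LocallyFinitePoints Z)
    (hne : Z.Nonempty) (x : Plane) : ∃ z ∈ Z, ∀ z' ∈ Z, dist x z ≤ dist x z' := by
  obtain ⟨z₀, hz₀⟩ := hne
  obtain ⟨z, hz, hmin⟩ := Set.exists_min_image (Z ∩ Metric.closedBall x (dist x z₀))
    (fun z => dist x z) (hZ _ Metric.isBounded_closedBall)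
    ⟨z₀, hz₀, by simp [dist_comm]⟩
  refine ⟨z, hz.1, fun z' hz' => ?_⟩
  rcases le_total (dist x z') (dist x z₀) with h | h
  · exact hmin z' ⟨hz', by simpa [dist_comm] using h⟩
  · exact (hmin z₀ ⟨hz₀, by simp [dist_comm]⟩).trans h

lemma mem_blackSet_iff_of_nearest {Zb Zw : Set Plane} (hb : LocallyFinitePoints Zb) {x : Plane} :
    x ∈ blackSet Zb Zw ↔ ∃ b ∈ Zb, ∀ z ∈ Zb ∪ Zw, dist x b ≤ dist x z := by
  constructor
  · rintro ⟨b, hbZ, h⟩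
    obtain ⟨b', hb', hmin⟩ := hb.exists_nearest ⟨b, hbZ⟩ x
    refine ⟨b', hb', ?_⟩
    rintro z (hz | hz)
    · exact hmin z hz
    · exact (hmin b hbZ).trans (h z hz)
  · rintro ⟨b, hbZ, h⟩
    exact ⟨b, hbZ, fun w hw => h w (Or.inr hw)⟩

lemma blackRegion_eq_blackSet {Zb Zw : Set Plane} (hb : LocallyFinitePoints Zb) :
    blackRegion Zb Zw = blackSet Zb Zw := by
  ext x
  rw [mem_blackSet_iff_of_nearest hb]
  simp only [blackRegion, cell, Set.mem_iUnion, Set.mem_ofPred_eq, exists_prop]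
  refine exists_congr fun b => and_congr_right fun hbZ => ?_
  have hbdd : BddBelow (Set.range fun z' : ↥(Zb ∪ Zw) => dist x (z' : Plane)) :=
    ⟨0, by rintro _ ⟨z, rfl⟩; exact dist_nonneg⟩
  have : Nonempty ↥(Zb ∪ Zw) := ⟨⟨b, Or.inl hbZ⟩⟩
  constructor
  · intro h z hz
    rw [h]
    exact ciInf_le hbdd ⟨z, hz⟩
  · intro h
    exact le_antisymm (le_ciInf fun z => h z z.2) (ciInf_le hbdd ⟨b, Or.inl hbZ⟩)

/-! ### Finite unions of convex sets -/

/-- The set of points reachable from `S` by piecewise linear paths in `K`. -/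
def reach (K S : Set Plane) : Set Plane := {y | ∃ x ∈ S, PLJoined K x y}

/-- In a finite union of compact convex sets, the points reachable from a given set and the
points not reachable from it both form compact sets. -/
lemma isCompact_reach_and_compl {ι : Type*} {F : Set ι} (hF : F.Finite) {P : ι → Set Plane}
    (hc : ∀ i, IsCompact (P i)) (hconv : ∀ i, Convex ℝ (P i)) (S : Set Plane) :
    IsCompact (reach (⋃ i ∈ F, P i) S) ∧ IsCompact ((⋃ i ∈ F, P i) \ reach (⋃ i ∈ F, P i) S) := by
  set K := ⋃ i ∈ F, P i with hK
  have hPK : ∀ i ∈ F, P i ⊆ K := fun i hi => Set.subset_biUnion_of_mem hi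
  have hreachK : reach K S ⊆ K := by
    rintro y ⟨x, -, h⟩
    exact h.right_mem
  have hspread : ∀ i ∈ F, (P i ∩ reach K S).Nonempty → P i ⊆ reach K S := by
    rintro i hi ⟨y, hy, x, hx, hxy⟩ z hz
    exact ⟨x, hx, hxy.trans ((PLJoined.of_convex (hconv i) hy hz).mono (hPK i hi))⟩
  have e1 : reach K S = ⋃ i ∈ {i ∈ F | (P i ∩ reach K S).Nonempty}, P i := by
    apply Set.Subset.antisymm
    · intro y hy
      obtain ⟨i, hi, hyi⟩ := Set.mem_iUnion₂.1 (hreachK hy)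
      exact Set.mem_iUnion₂.2 ⟨i, ⟨hi, y, hyi, hy⟩, hyi⟩
    · exact Set.iUnion₂_subset fun i hi => hspread i hi.1 hi.2
  have e2 : K \ reach K S = ⋃ i ∈ {i ∈ F | ¬ (P i ∩ reach K S).Nonempty}, P i := by
    apply Set.Subset.antisymm
    · rintro y ⟨hyK, hy⟩
      obtain ⟨i, hi, hyi⟩ := Set.mem_iUnion₂.1 hyK
      exact Set.mem_iUnion₂.2 ⟨i, ⟨hi, fun h => hy (hspread i hi h hyi)⟩, hyi⟩
    · refine Set.iUnion₂_subset fun i hi y hy => ⟨hPK i hi.1 hy, fun h => hi.2 ⟨y, hy, h⟩⟩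
  constructor
  · rw [e1]
    exact (hF.subset fun i hi => hi.1).isCompact_biUnion fun i _ => hc i
  · rw [e2]
    exact (hF.subset fun i hi => hi.1).isCompact_biUnion fun i _ => hc i

lemma convex_setOf_dist_le_dist (b z : Plane) : Convex ℝ {x : Plane | dist x b ≤ dist x z} := by
  have : {x : Plane | dist x b ≤ dist x z}
      = {x : Plane | (innerSL ℝ (z - b)) x ≤ (‖z‖ ^ 2 - ‖b‖ ^ 2) / 2} := by
    ext x
    simp only [Set.mem_ofPred_eq, innerSL_apply_apply]
    rw [dist_eq_norm, dist_eq_norm, ← sq_le_sq₀ (norm_nonneg _) (norm_nonneg _),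
      @norm_sub_sq ℝ, @norm_sub_sq ℝ, inner_sub_left, real_inner_comm x z, real_inner_comm x b]
    simp only [RCLike.re_to_real]
    constructor <;> intro h <;> linarith
  rw [this]
  exact convex_halfSpace_le (innerSL ℝ (z - b)).toLinearMap.isLinear _

/-- Inside a compact convex set, the black set is a finite union of compact convex pieces of
Voronoi cells. -/
lemma exists_convex_pieces {R Zb Zw : Set Plane} (hR : IsCompact R) (hRc : Convex ℝ R)
    (hb : LocallyFinitePoints Zb) :
    ∃ (F : Set Plane) (P : Plane → Set Plane), F.Finite ∧ (∀ i, IsCompact (P i)) ∧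
      (∀ i, Convex ℝ (P i)) ∧ R ∩ blackSet Zb Zw = ⋃ i ∈ F, P i := by
  let P : Plane → Set Plane := fun b => R ∩ ⋂ z ∈ Zb ∪ Zw, {x | dist x b ≤ dist x z}
  have hclosed : ∀ b, IsClosed (⋂ z ∈ Zb ∪ Zw, {x : Plane | dist x b ≤ dist x z}) := fun b =>
    isClosed_biInter fun z _ => isClosed_le (by fun_prop) (by fun_prop)
  refine ⟨{b ∈ Zb | (P b).Nonempty}, P, ?_, fun b => hR.inter_right (hclosed b),
    fun b => hRc.inter (convex_iInter₂ fun z _ => convex_setOf_dist_le_dist b z), ?_⟩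
  · rcases Zb.eq_empty_or_nonempty with h | ⟨b₀, hb₀⟩
    · simp [h]
    · obtain ⟨C, hC⟩ := hR.isBounded.subset_closedBall b₀
      refine (hb _ (Metric.isBounded_closedBall (x := b₀) (r := 2 * C))).subset ?_
      rintro b ⟨hbZ, x, hxR, hx⟩
      refine ⟨hbZ, ?_⟩
      have h1 : dist x b ≤ dist x b₀ := by
        have := Set.mem_iInter₂.1 hx b₀ (Or.inl hb₀)
        exact this
      have h2 : dist x b₀ ≤ C := hC hxR
      have h3 := dist_triangle_left b b₀ x
      simp only [Metric.mem_closedBall]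
      linarith
  · ext x
    simp only [Set.mem_inter_iff, Set.mem_iUnion, Set.mem_ofPred_eq, exists_prop, P,
      Set.mem_iInter]
    rw [mem_blackSet_iff_of_nearest hb]
    constructor
    · rintro ⟨hx, b, hbZ, h⟩
      exact ⟨b, ⟨hbZ, x, hx, Set.mem_iInter₂.2 h⟩, hx, h⟩
    · rintro ⟨b, ⟨hbZ, -⟩, hx, h⟩
      exact ⟨hx, b, hbZ, h⟩

/-- If black paths in `R` lead from `S` to each of a decreasing sequence of closed sets, then some
black path in `R` leads from `S` to their intersection. -/
lemma Conn.iInter {R S Zb Zw : Set Plane} {T : ℕ → Set Plane} (hR : IsCompact R)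
    (hRc : Convex ℝ R) (hb : LocallyFinitePoints Zb) (hT : ∀ n, IsClosed (T n)) (hTa : Antitone T)
    (h : ∀ n, Conn R S (T n) Zb Zw) : Conn R S (⋂ n, T n) Zb Zw := by
  obtain ⟨F, P, hF, hPc, hPconv, hK⟩ := exists_convex_pieces (Zw := Zw) hR hRc hb
  have hA := (isCompact_reach_and_compl hF hPc hPconv S).1
  rw [← hK] at hA
  have := IsCompact.nonempty_iInter_of_sequence_nonempty_isCompact_isClosed
    (fun n => reach (R ∩ blackSet Zb Zw) S ∩ T n)
    (fun n => Set.inter_subset_inter_right _ (hTa n.le_succ))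
    (fun n => by
      obtain ⟨x, hx, y, hy, hxy⟩ := h n
      exact ⟨y, ⟨x, hx, hxy⟩, hy⟩)
    (hA.inter_right (hT 0)) (fun n => hA.isClosed.inter (hT n))
  obtain ⟨y, hy⟩ := this
  simp only [Set.mem_iInter, Set.mem_inter_iff] at hy
  obtain ⟨x, hx, hxy⟩ := (hy 0).1
  exact ⟨x, hx, y, Set.mem_iInter.2 fun n => (hy n).2, hxy⟩

/-! ### Closed increasing events -/

/-- In the ball of radius `n`, and up to an error of `1 / (n + 1)`, the configuration
`(Yb, Yw)` has no black points beyond those of `(Zb, Zw)`, and all its white points. -/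
def Approx (n : ℕ) (Yb Yw Zb Zw : Set Plane) : Prop :=
  (∀ y ∈ Yb, ‖y‖ ≤ n → ∃ z ∈ Zb, dist y z ≤ 1 / (n + 1 : ℝ)) ∧
    ∀ w ∈ Zw, ‖w‖ ≤ n → ∃ y ∈ Yw, dist w y ≤ 1 / (n + 1 : ℝ)

lemma Approx.of_le {m n : ℕ} (hmn : m ≤ n) {Yb Yw Zb Zw : Set Plane} (h : Approx n Yb Yw Zb Zw) :
    Approx m Yb Yw Zb Zw := by
  have h1 : (m : ℝ) ≤ n := by exact_mod_cast hmn
  have h2 : 1 / (n + 1 : ℝ) ≤ 1 / (m + 1 : ℝ) :=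
    one_div_le_one_div_of_le (by positivity) (by linarith)
  constructor
  · intro y hy hym
    obtain ⟨z, hz, hd⟩ := h.1 y hy (hym.trans h1)
    exact ⟨z, hz, hd.trans h2⟩
  · intro y hy hym
    obtain ⟨z, hz, hd⟩ := h.2 y hy (hym.trans h1)
    exact ⟨z, hz, hd.trans h2⟩

/-- A property of black and white point sets that is preserved under adding black points and
removing white ones, and that holds for a locally finite configuration as soon as it holds for
configurations approximating it from the white side. -/
structure ClosedIncreasing (Q : Set Plane → Set Plane → Prop) : Prop where
  mono : ∀ {Yb Yw Yb' Yw' : Set Plane}, Yb ⊆ Yb' → Yw' ⊆ Yw → Q Yb Yw → Q Yb' Yw'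
  closed : ∀ {Zb Zw : Set Plane}, LocallyFinitePoints Zb → Zb.Nonempty →
    (∀ n, ∃ Yb Yw, Approx n Yb Yw Zb Zw ∧ Q Yb Yw) → Q Zb Zw

lemma ClosedIncreasing.and {Q Q' : Set Plane → Set Plane → Prop} (hQ : ClosedIncreasing Q)
    (hQ' : ClosedIncreasing Q') : ClosedIncreasing fun Yb Yw => Q Yb Yw ∧ Q' Yb Yw where
  mono hb hw h := ⟨hQ.mono hb hw h.1, hQ'.mono hb hw h.2⟩
  closed hb hne h := by
    constructor
    · refine hQ.closed hb hne fun n => ?_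
      obtain ⟨Yb, Yw, hY, hq, -⟩ := h n
      exact ⟨Yb, Yw, hY, hq⟩
    · refine hQ'.closed hb hne fun n => ?_
      obtain ⟨Yb, Yw, hY, -, hq⟩ := h n
      exact ⟨Yb, Yw, hY, hq⟩

/-- Limits of points that are black in approximating configurations are black. -/
lemma mem_blackSet_of_tendsto {Zb Zw : Set Plane} (hb : LocallyFinitePoints Zb)
    (hne : Zb.Nonempty) {x : Plane} {u : ℕ → Plane} {N : ℕ → ℕ} {Yb Yw : ℕ → Set Plane}
    (hN : Tendsto N atTop atTop) (hY : ∀ k, Approx (N k) (Yb k) (Yw k) Zb Zw)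
    (hu : ∀ k, u k ∈ blackSet (Yb k) (Yw k)) (hux : Tendsto u atTop (nhds x)) :
    x ∈ blackSet Zb Zw := by
  obtain ⟨b, hbZ, hmin⟩ := hb.exists_nearest hne x
  refine ⟨b, hbZ, fun w hw => ?_⟩
  by_contra hlt
  push Not at hlt
  have hd : Tendsto (fun k => dist (u k) x) atTop (nhds 0) := tendsto_iff_dist_tendsto_zero.1 hux
  have hε : Tendsto (fun k => 1 / ((N k : ℝ) + 1)) atTop (nhds 0) :=
    (tendsto_one_div_add_atTop_nhds_zero_nat (𝕜 := ℝ)).comp hN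
  have hη : 0 < (dist x b - dist x w) / 4 := by linarith
  have hNr : Tendsto (fun k => (N k : ℝ)) atTop atTop := tendsto_natCast_atTop_atTop.comp hN
  obtain ⟨k, hk1, hk2, hk3, hk4⟩ := ((hd.eventually_lt_const hη).and
    ((hε.eventually_lt_const hη).and ((hNr.eventually_ge_atTop ‖w‖).and
      (hNr.eventually_ge_atTop (dist x b + ‖x‖))))).exists
  obtain ⟨y, hyY, hy⟩ := hu k
  obtain ⟨w', hw'Y, hw'⟩ := (hY k).2 w hw hk3
  have h1 := hy w' hw'Y
  have t1 := dist_triangle (u k) w w'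
  have t2 := dist_triangle (u k) x w
  -- the black point seen from `u k` is at distance less than `dist x b` from `x`
  have t3 := dist_triangle_left x y (u k)
  have hyn : ‖y‖ ≤ N k := by
    have := norm_le_norm_add_norm_sub' y x
    rw [← dist_eq_norm, dist_comm] at this
    linarith
  obtain ⟨z, hzZ, hz⟩ := (hY k).1 y hyY hyn
  have t4 := dist_triangle x y z
  have := hmin z hzZ
  linarith

/-- A compact set without black points has no black points in approximating configurations. -/
lemma exists_forall_approx_disjoint {Zb Zw C : Set Plane} (hb : LocallyFinitePoints Zb)
    (hne : Zb.Nonempty) (hC : IsCompact C) (hd : ∀ x ∈ C, x ∉ blackSet Zb Zw) :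
    ∃ n, ∀ Yb Yw, Approx n Yb Yw Zb Zw → ∀ x ∈ C, x ∉ blackSet Yb Yw := by
  by_contra hcon
  push Not at hcon
  choose Yb Yw hY u hu hub using hcon
  obtain ⟨x, hx, φ, hφ, hlim⟩ := hC.tendsto_subseq hu
  exact hd x hx (mem_blackSet_of_tendsto hb hne hφ.tendsto_atTop (fun k => hY (φ k))
    (fun k => hub (φ k)) hlim)

/-- Connections are closed increasing events: if no black path in `R` joins `S` to `T`, then the
part of the black set reachable from `S` and the rest of it have disjoint neighbourhoods, which
contain the black set of all sufficiently close configurations. -/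
lemma closedIncreasing_conn {R S T : Set Plane} (hR : IsCompact R) (hRc : Convex ℝ R)
    (hS : IsClosed S) (hT : IsClosed T) : ClosedIncreasing (Conn R S T) where
  mono := by
    rintro Yb Yw Yb' Yw' hb hw ⟨x, hx, y, hy, h⟩
    exact ⟨x, hx, y, hy, h.mono (Set.inter_subset_inter_right _ (blackSet_mono hb hw))⟩
  closed := by
    intro Zb Zw hb hne h
    by_contra hcon
    obtain ⟨F, P, hF, hPc, hPconv, hK⟩ := exists_convex_pieces (Zw := Zw) hR hRc hb
    obtain ⟨hA, hB⟩ := isCompact_reach_and_compl hF hPc hPconv S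
    rw [← hK] at hA hB
    -- disjoint neighbourhoods of the reachable and the unreachable part of the black set
    obtain ⟨U, V, hU, hV, hAU, hBV, hUV⟩ :=
      SeparatedNhds.of_isCompact_isCompact hA hB Set.disjoint_sdiff_right
    have hC₁ : ∃ n, ∀ Yb Yw, Approx n Yb Yw Zb Zw → ∀ x ∈ R \ (U ∪ V), x ∉ blackSet Yb Yw := by
      refine exists_forall_approx_disjoint hb hne (hR.diff (hU.union hV)) ?_
      rintro x ⟨hxR, hxUV⟩ hxb
      by_cases hxr : x ∈ reach (R ∩ blackSet Zb Zw) S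
      · exact hxUV (Or.inl (hAU hxr))
      · exact hxUV (Or.inr (hBV ⟨⟨hxR, hxb⟩, hxr⟩))
    have hC₂ : ∃ n, ∀ Yb Yw, Approx n Yb Yw Zb Zw →
        ∀ x ∈ (R ∩ S) \ U, x ∉ blackSet Yb Yw := by
      refine exists_forall_approx_disjoint hb hne ((hR.inter_right hS).diff hU) ?_
      rintro x ⟨⟨hxR, hxS⟩, hxU⟩ hxb
      exact hxU (hAU ⟨x, hxS, PLJoined.refl ⟨hxR, hxb⟩⟩)
    have hC₃ : ∃ n, ∀ Yb Yw, Approx n Yb Yw Zb Zw →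
        ∀ x ∈ (R ∩ T) \ V, x ∉ blackSet Yb Yw := by
      refine exists_forall_approx_disjoint hb hne ((hR.inter_right hT).diff hV) ?_
      rintro y ⟨⟨hyR, hyT⟩, hyV⟩ hyb
      refine hyV (hBV ⟨⟨hyR, hyb⟩, ?_⟩)
      rintro ⟨x, hx, hxy⟩
      exact hcon ⟨x, hx, y, hyT, hxy⟩
    obtain ⟨n₁, hn₁⟩ := hC₁
    obtain ⟨n₂, hn₂⟩ := hC₂
    obtain ⟨n₃, hn₃⟩ := hC₃
    obtain ⟨Yb, Yw, hY, x, hx, y, hy, hxy⟩ := h (max n₁ (max n₂ n₃))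
    have hY₁ := hY.of_le (le_max_left n₁ (max n₂ n₃))
    have hY₂ := hY.of_le ((le_max_left n₂ n₃).trans (le_max_right n₁ _))
    have hY₃ := hY.of_le ((le_max_right n₂ n₃).trans (le_max_right n₁ _))
    obtain ⟨γ, hγ⟩ := hxy.exists_path
    have hsub : Set.range γ ⊆ U ∪ V := by
      rintro _ ⟨t, rfl⟩
      have := (hγ t).right_mem
      by_contra hUV'
      exact hn₁ Yb Yw hY₁ (γ t) ⟨this.1, hUV'⟩ this.2
    have hxU : x ∈ U := by
      by_contra hxU
      exact hn₂ Yb Yw hY₂ x ⟨⟨hxy.left_mem.1, hx⟩, hxU⟩ hxy.left_mem.2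
    have hyV : y ∈ V := by
      by_contra hyV
      exact hn₃ Yb Yw hY₃ y ⟨⟨hxy.right_mem.1, hy⟩, hyV⟩ hxy.right_mem.2
    obtain ⟨z, -, hz⟩ := (isPreconnected_range γ.continuous) U V hU hV hsub
      ⟨x, γ.source_mem_range, hxU⟩ ⟨y, γ.target_mem_range, hyV⟩
    exact Set.disjoint_left.1 hUV hz.1 hz.2

/-! ### Discretization of the Poisson process -/

/-- A partition of a set containing the ball of radius `k` into finitely many Borel cells of
diameter at most `1 / (k + 1)`. -/
structure CellPartition (k : ℕ) where
  /-- the number of cells -/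
  size : ℕ
  /-- the cells -/
  part : Fin size → Set Plane
  measurable : ∀ i, MeasurableSet (part i)
  disjoint : Pairwise fun i j => Disjoint (part i) (part j)
  volume_ne_top : ∀ i, volume (part i) ≠ ∞
  cover : ∀ x : Plane, ‖x‖ ≤ k → ∃ i, x ∈ part i
  dist_le : ∀ i, ∀ x ∈ part i, ∀ y ∈ part i, dist x y ≤ 1 / (k + 1 : ℝ)

lemma nonempty_cellPartition (k : ℕ) : Nonempty (CellPartition k) := by
  have hr : (0 : ℝ) < 1 / (2 * (k + 1 : ℝ)) := by positivity
  obtain ⟨t, -, ht, hcov⟩ :=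
    (isCompact_closedBall (0 : Plane) (k : ℝ)).finite_cover_balls hr
  let e := (ht.toFinset).equivFin
  let f : Fin ht.toFinset.card → Set Plane := fun i =>
    Metric.ball ((e.symm i : Plane)) (1 / (2 * (k + 1 : ℝ)))
  refine ⟨⟨ht.toFinset.card, disjointed f, ?_, ?_, ?_, ?_, ?_⟩⟩
  · intro i
    exact disjointedRec (fun _ _ hs => hs.diff measurableSet_ball) measurableSet_ball
  · exact disjoint_disjointed f
  · intro i
    exact ((measure_mono (disjointed_subset f i)).trans_lt measure_ball_lt_top).ne
  · intro x hx
    obtain ⟨c, hc, hxc⟩ := Set.mem_iUnion₂.1 (hcov (by simpa using hx))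
    have : x ∈ ⋃ i, f i :=
      Set.mem_iUnion.2 ⟨e ⟨c, by simpa using hc⟩, by simpa [f] using hxc⟩
    rw [← iUnion_disjointed] at this
    exact Set.mem_iUnion.1 this
  · intro i x hx y hy
    have h1 : dist x (e.symm i : Plane) < 1 / (2 * (k + 1 : ℝ)) := disjointed_subset f i hx
    have h2 : dist y (e.symm i : Plane) < 1 / (2 * (k + 1 : ℝ)) := disjointed_subset f i hy
    have h3 := dist_triangle_right x y (e.symm i : Plane)
    have h4 : 1 / (2 * (k + 1 : ℝ)) + 1 / (2 * (k + 1 : ℝ)) = 1 / (k + 1 : ℝ) := by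
      field_simp
      norm_num
    linarith

/-- The cells of a partition that contain a point of `Y`. -/
noncomputable def occupied {k : ℕ} (𝒢 : CellPartition k) (Y : Set Plane) :
    Finset (Fin 𝒢.size) := by
  classical exact Finset.univ.filter fun i => (Y ∩ 𝒢.part i).Nonempty

lemma mem_occupied {k : ℕ} {𝒢 : CellPartition k} {Y : Set Plane} {i : Fin 𝒢.size} :
    i ∈ occupied 𝒢 Y ↔ (Y ∩ 𝒢.part i).Nonempty := by
  simp [occupied]

/-- The sets of cells `(A, A')` that, as occupied black and white cells, do not rule out `Q`: some
configuration with property `Q` has black points only in the cells `A` and outside all the cells,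
and white points in all the cells of `A'`. -/
def cellEvent {k : ℕ} (𝒢 : CellPartition k) (Q : Set Plane → Set Plane → Prop) :
    Set (Finset (Fin 𝒢.size) × Finset (Fin 𝒢.size)) :=
  {a | ∃ Yb Yw, Q Yb Yw ∧ occupied 𝒢 Yb ⊆ a.1 ∧ a.2 ⊆ occupied 𝒢 Yw}

lemma cellEvent_mono {k : ℕ} {𝒢 : CellPartition k} {Q : Set Plane → Set Plane → Prop}
    {a b : Finset (Fin 𝒢.size) × Finset (Fin 𝒢.size)} (h₁ : a.1 ⊆ b.1) (h₂ : b.2 ⊆ a.2)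
    (ha : a ∈ cellEvent 𝒢 Q) : b ∈ cellEvent 𝒢 Q := by
  obtain ⟨Yb, Yw, hQ, hb, hw⟩ := ha
  exact ⟨Yb, Yw, hQ, hb.trans h₁, h₂.trans hw⟩

lemma exists_approx_of_mem_cellEvent {k : ℕ} {𝒢 : CellPartition k}
    {Q : Set Plane → Set Plane → Prop} {Zb Zw : Set Plane}
    (h : (occupied 𝒢 Zb, occupied 𝒢 Zw) ∈ cellEvent 𝒢 Q) :
    ∃ Yb Yw, Approx k Yb Yw Zb Zw ∧ Q Yb Yw := by
  obtain ⟨Yb, Yw, hQ, hb, hw⟩ := h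
  refine ⟨Yb, Yw, ⟨fun y hy hyk => ?_, fun w hw' hwk => ?_⟩, hQ⟩
  · obtain ⟨i, hi⟩ := 𝒢.cover y hyk
    obtain ⟨z, hz, hzi⟩ := mem_occupied.1 (hb (mem_occupied.2 ⟨y, hy, hi⟩))
    exact ⟨z, hz, 𝒢.dist_le i y hi z hzi⟩
  · obtain ⟨i, hi⟩ := 𝒢.cover w hwk
    obtain ⟨y, hy, hyi⟩ := mem_occupied.1 (hw (mem_occupied.2 ⟨w, hw', hi⟩))
    exact ⟨y, hy, 𝒢.dist_le i w hi y hyi⟩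

lemma ClosedIncreasing.eventually_mem_cellEvent_iff {Q : Set Plane → Set Plane → Prop}
    (hQ : ClosedIncreasing Q) (𝒢 : ∀ k, CellPartition k) {Zb Zw : Set Plane}
    (hb : LocallyFinitePoints Zb) (hne : Zb.Nonempty) :
    ∀ᶠ k in atTop,
      (occupied (𝒢 k) Zb, occupied (𝒢 k) Zw) ∈ cellEvent (𝒢 k) Q ↔ Q Zb Zw := by
  by_cases h : Q Zb Zw
  · exact Eventually.of_forall fun k =>
      iff_of_true ⟨Zb, Zw, h, Finset.Subset.refl _, Finset.Subset.refl _⟩ h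
  · have : ∃ n, ∀ Yb Yw, Approx n Yb Yw Zb Zw → ¬ Q Yb Yw := by
      by_contra hcon
      push Not at hcon
      exact h (hQ.closed hb hne hcon)
    obtain ⟨n, hn⟩ := this
    filter_upwards [eventually_ge_atTop n] with k hk
    refine iff_of_false (fun hmem => ?_) h
    obtain ⟨Yb, Yw, hY, hq⟩ := exists_approx_of_mem_cellEvent hmem
    exact hn Yb Yw (hY.of_le hk) hq

/-! ### The law of the occupied cells -/

lemma setOf_occupied_eq {Ω : Type*} {k : ℕ} (𝒢 : CellPartition k) (Z : Ω → Set Plane)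
    (A : Finset (Fin 𝒢.size)) :
    {ω | occupied 𝒢 (Z ω) = A}
      = ⋂ i, count Z (𝒢.part i) ⁻¹' (if i ∈ A then {0}ᶜ else {0}) := by
  ext ω
  simp only [Set.mem_ofPred_eq, Set.mem_iInter, Finset.ext_iff, mem_occupied]
  refine forall_congr' fun i => ?_
  by_cases hi : i ∈ A
  · simp [hi, count, Set.nonempty_iff_ne_empty]
  · simp [hi, count, Set.not_nonempty_iff_eq_empty]

lemma count_image {Ω : Type*} (g : Plane ≃ᵃⁱ[ℝ] Plane) (Z : Ω → Set Plane) (B : Set Plane) :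
    count (fun ω => g '' Z ω) B = count Z (g ⁻¹' B) := by
  funext ω
  have : g '' Z ω ∩ B = g '' (Z ω ∩ g ⁻¹' B) := (Set.image_inter_preimage g (Z ω) B).symm
  simp only [count]
  rw [this, g.injective.encard_image]

lemma measurableSet_countSigma_occupied {Ω : Type*} {k : ℕ} (𝒢 : CellPartition k)
    (Z : Ω → Set Plane) (A : Finset (Fin 𝒢.size)) :
    MeasurableSet[countSigma Z] {ω | occupied 𝒢 (Z ω) = A} := by
  rw [setOf_occupied_eq]
  refine @MeasurableSet.iInter _ _ (countSigma Z) _ _ fun i => ?_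
  refine (le_iSup₂_of_le (f := fun (B : Set Plane) (_ : MeasurableSet B) =>
    MeasurableSpace.comap (count Z B) inferInstance) (𝒢.part i) (𝒢.measurable i) le_rfl) _ ?_
  exact ⟨_, MeasurableSet.of_discrete, rfl⟩

lemma countSigma_image_le {Ω : Type*} (g : Plane ≃ᵃⁱ[ℝ] Plane)
    (hg : MeasurePreserving g volume volume) (Z : Ω → Set Plane) :
    countSigma (fun ω => g '' Z ω) ≤ countSigma Z := by
  refine iSup₂_le fun B hB => ?_
  rw [count_image]
  exact le_iSup₂_of_le (f := fun (B : Set Plane) (_ : MeasurableSet B) =>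
    MeasurableSpace.comap (count Z B) inferInstance) (g ⁻¹' B) (hg.measurable hB) le_rfl

section Law

variable {Ω : Type*} [MeasurableSpace Ω] {μ : Measure Ω}

/-- The probability that exactly the cells `A` are occupied, for a Poisson process of intensity
`r`. -/
noncomputable def occupationWeight {k : ℕ} (𝒢 : CellPartition k) (r : ℝ≥0)
    (A : Finset (Fin 𝒢.size)) : ℝ≥0∞ :=
  ∏ i, (poissonMeasure (r * (volume (𝒢.part i)).toNNReal)).map (fun n : ℕ => (n : ℕ∞))
    (if i ∈ A then {0}ᶜ else {0})

lemma IsPoissonProcess.countSigma_le {Z : Ω → Set Plane} {r : ℝ≥0}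
    (hZ : IsPoissonProcess μ Z r) : countSigma Z ≤ ‹MeasurableSpace Ω› :=
  iSup₂_le fun B hB => (hZ.measurable_count B hB).comap_le

lemma IsPoissonProcess.measure_occupied {Z : Ω → Set Plane} {r : ℝ≥0}
    (hZ : IsPoissonProcess μ Z r) {k : ℕ} (𝒢 : CellPartition k) (A : Finset (Fin 𝒢.size)) :
    μ {ω | occupied 𝒢 (Z ω) = A} = occupationWeight 𝒢 r A := by
  rw [setOf_occupied_eq]
  have h := (hZ.indep_count 𝒢.size 𝒢.part 𝒢.measurable
    𝒢.disjoint).measure_inter_preimage_eq_mul Finset.univ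
    (sets := fun i => if i ∈ A then {0}ᶜ else {0}) (fun _ _ => MeasurableSet.of_discrete)
  simp only [Finset.mem_univ, Set.iInter_true] at h
  rw [h, occupationWeight]
  refine Finset.prod_congr rfl fun i _ => ?_
  rw [← hZ.law_count _ (𝒢.measurable i) (𝒢.volume_ne_top i),
    Measure.map_apply (hZ.measurable_count _ (𝒢.measurable i)) MeasurableSet.of_discrete]

/-- The joint law of the occupied black and white cells. -/
noncomputable def cellLaw {k : ℕ} (𝒢 : CellPartition k) (p : ℝ)
    (a : Finset (Fin 𝒢.size) × Finset (Fin 𝒢.size)) : ℝ :=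
  (occupationWeight 𝒢 p.toNNReal a.1 * occupationWeight 𝒢 (1 - p).toNNReal a.2).toReal

lemma cellLaw_nonneg {k : ℕ} (𝒢 : CellPartition k) (p : ℝ) : 0 ≤ cellLaw 𝒢 p :=
  fun _ => ENNReal.toReal_nonneg

/-- The pair of the sets of occupied black and white cells. -/
noncomputable def cells {k : ℕ} (𝒢 : CellPartition k) (Zb Zw : Ω → Set Plane) (ω : Ω) :
    Finset (Fin 𝒢.size) × Finset (Fin 𝒢.size) :=
  (occupied 𝒢 (Zb ω), occupied 𝒢 (Zw ω))

variable {Zb Zw : Ω → Set Plane} {p : ℝ}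

lemma IsColouredPoisson.measurableSet_cells_fiber (hZ : IsColouredPoisson μ Zb Zw p) {k : ℕ}
    (𝒢 : CellPartition k) (a : Finset (Fin 𝒢.size) × Finset (Fin 𝒢.size)) :
    MeasurableSet (cells 𝒢 Zb Zw ⁻¹' {a}) := by
  have : cells 𝒢 Zb Zw ⁻¹' {a}
      = {ω | occupied 𝒢 (Zb ω) = a.1} ∩ {ω | occupied 𝒢 (Zw ω) = a.2} := by
    ext ω
    simp [cells, Prod.ext_iff]
  rw [this]
  exact (hZ.black.countSigma_le _ (measurableSet_countSigma_occupied 𝒢 Zb a.1)).inter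
    (hZ.white.countSigma_le _ (measurableSet_countSigma_occupied 𝒢 Zw a.2))

lemma IsColouredPoisson.measure_cells_fiber (hZ : IsColouredPoisson μ Zb Zw p) {k : ℕ}
    (𝒢 : CellPartition k) (a : Finset (Fin 𝒢.size) × Finset (Fin 𝒢.size)) :
    μ.real (cells 𝒢 Zb Zw ⁻¹' {a}) = cellLaw 𝒢 p a := by
  have : cells 𝒢 Zb Zw ⁻¹' {a}
      = {ω | occupied 𝒢 (Zb ω) = a.1} ∩ {ω | occupied 𝒢 (Zw ω) = a.2} := by
    ext ω
    simp [cells, Prod.ext_iff]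
  rw [this, measureReal_def, (Indep_iff _ _ μ).1 hZ.indep _ _
    (measurableSet_countSigma_occupied 𝒢 Zb a.1) (measurableSet_countSigma_occupied 𝒢 Zw a.2),
    hZ.black.measure_occupied, hZ.white.measure_occupied, cellLaw]

lemma IsColouredPoisson.measurableSet_cells_preimage (hZ : IsColouredPoisson μ Zb Zw p) {k : ℕ}
    (𝒢 : CellPartition k) (S : Set (Finset (Fin 𝒢.size) × Finset (Fin 𝒢.size))) :
    MeasurableSet (cells 𝒢 Zb Zw ⁻¹' S) := by
  rw [← Set.biUnion_preimage_singleton]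
  exact MeasurableSet.biUnion (Set.to_countable S) fun a _ => hZ.measurableSet_cells_fiber 𝒢 a

lemma IsColouredPoisson.measure_cells_preimage [IsFiniteMeasure μ]
    (hZ : IsColouredPoisson μ Zb Zw p) {k : ℕ}
    (𝒢 : CellPartition k) (S : Set (Finset (Fin 𝒢.size) × Finset (Fin 𝒢.size))) :
    μ.real (cells 𝒢 Zb Zw ⁻¹' S) = ∑ a, cellLaw 𝒢 p a * S.indicator 1 a := by
  classical
  have h := sum_measureReal_preimage_singleton (μ := μ) (Finset.univ.filter (· ∈ S))
    (fun a _ => hZ.measurableSet_cells_fiber 𝒢 a)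
  simp only [Finset.coe_filter, Finset.mem_univ, true_and, Set.ofPred_mem_eq] at h
  rw [← h, Finset.sum_filter]
  refine Finset.sum_congr rfl fun a _ => ?_
  by_cases ha : a ∈ S <;> simp [ha, hZ.measure_cells_fiber]

lemma occupationWeight_mul {k : ℕ} (𝒢 : CellPartition k) (r : ℝ≥0)
    (A B : Finset (Fin 𝒢.size)) :
    occupationWeight 𝒢 r A * occupationWeight 𝒢 r B
      = occupationWeight 𝒢 r (A ⊓ B) * occupationWeight 𝒢 r (A ⊔ B) := by
  simp only [occupationWeight, ← Finset.prod_mul_distrib]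
  refine Finset.prod_congr rfl fun i _ => ?_
  by_cases hA : i ∈ A <;> by_cases hB : i ∈ B <;> simp [hA, hB, mul_comm]

/-- Harris' inequality for the occupied cells. -/
lemma IsColouredPoisson.measure_cells_inter_ge [IsProbabilityMeasure μ]
    (hZ : IsColouredPoisson μ Zb Zw p) {k : ℕ} (𝒢 : CellPartition k)
    (Q Q' : Set Plane → Set Plane → Prop) :
    μ.real (cells 𝒢 Zb Zw ⁻¹' cellEvent 𝒢 Q) * μ.real (cells 𝒢 Zb Zw ⁻¹' cellEvent 𝒢 Q')
      ≤ μ.real (cells 𝒢 Zb Zw ⁻¹' (cellEvent 𝒢 Q ∩ cellEvent 𝒢 Q')) := by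
  classical
  -- the order on pairs of sets of cells for which adding black points and removing white ones
  -- goes up
  let α := Finset (Fin 𝒢.size) × (Finset (Fin 𝒢.size))ᵒᵈ
  let w : α → ℝ := fun a => cellLaw 𝒢 p (a.1, OrderDual.ofDual a.2)
  let ind : (Set Plane → Set Plane → Prop) → α → ℝ := fun q a =>
    (cellEvent 𝒢 q).indicator 1 (a.1, OrderDual.ofDual a.2)
  have hnn : ∀ q, 0 ≤ ind q := fun q a => Set.indicator_nonneg (by simp) _
  have hmono : ∀ q, Monotone (ind q) := by
    intro q a b hab
    by_cases ha : (a.1, OrderDual.ofDual a.2) ∈ cellEvent 𝒢 q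
    · have hb : (b.1, OrderDual.ofDual b.2) ∈ cellEvent 𝒢 q := cellEvent_mono hab.1 hab.2 ha
      simp [ind, ha, hb]
    · simpa [ind, ha] using hnn q b
  have hmod : ∀ a b, w a * w b ≤ w (a ⊓ b) * w (a ⊔ b) := by
    intro a b
    simp only [w, cellLaw, ← ENNReal.toReal_mul]
    apply le_of_eq
    congr 1
    have h1 := occupationWeight_mul 𝒢 p.toNNReal a.1 b.1
    have h2 := occupationWeight_mul 𝒢 (1 - p).toNNReal (OrderDual.ofDual a.2)
      (OrderDual.ofDual b.2)
    rw [mul_mul_mul_comm, h1, h2]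
    change _ = occupationWeight 𝒢 _ (a.1 ⊓ b.1)
        * occupationWeight 𝒢 _ (OrderDual.ofDual a.2 ⊔ OrderDual.ofDual b.2)
      * (occupationWeight 𝒢 _ (a.1 ⊔ b.1)
        * occupationWeight 𝒢 _ (OrderDual.ofDual a.2 ⊓ OrderDual.ofDual b.2))
    ring
  have key := fkg (μ := w) (f := ind Q) (g := ind Q') (fun a => cellLaw_nonneg 𝒢 p _)
    (hnn Q) (hnn Q') (hmono Q) (hmono Q') hmod
  have hone : ∑ a, w a = 1 := by
    have := hZ.measure_cells_preimage 𝒢 Set.univ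
    simp only [Set.preimage_univ, probReal_univ, Set.indicator_univ, Pi.one_apply,
      mul_one] at this
    exact this.symm
  rw [hone, one_mul] at key
  rw [hZ.measure_cells_preimage, hZ.measure_cells_preimage, hZ.measure_cells_preimage]
  refine key.trans (le_of_eq (Finset.sum_congr rfl fun a _ => ?_))
  congr 1
  rw [Set.inter_indicator_one]
  rfl

/-! ### Probabilities of closed increasing events -/

lemma IsPoissonProcess.ae_nonempty {Z : Ω → Set Plane} {r : ℝ≥0}
    (hZ : IsPoissonProcess μ Z r) (hr : 0 < r) : ∀ᵐ ω ∂μ, (Z ω).Nonempty := by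
  have hle : ∀ n : ℕ, μ {ω | ¬ (Z ω).Nonempty}
      ≤ ENNReal.ofReal (Real.exp (-(r * ((n : ℝ) ^ 2 * Real.pi)))) := by
    intro n
    have hsub : {ω | ¬ (Z ω).Nonempty} ⊆ count Z (Metric.ball 0 n) ⁻¹' {0} := by
      intro ω hω
      have : Z ω = ∅ := Set.not_nonempty_iff_eq_empty.1 hω
      simp [count, this]
    refine (measure_mono hsub).trans (le_of_eq ?_)
    rw [← Measure.map_apply (hZ.measurable_count _ measurableSet_ball) MeasurableSet.of_discrete,
      hZ.law_count _ measurableSet_ball measure_ball_lt_top.ne,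
      Measure.map_apply (by fun_prop) MeasurableSet.of_discrete]
    have h0 : (fun n : ℕ => (n : ℕ∞)) ⁻¹' {0} = {0} := by
      ext m
      simp
    rw [h0, poissonMeasure_singleton]
    have hv : ((volume (Metric.ball (0 : Plane) n)).toNNReal : ℝ) = (n : ℝ) ^ 2 * Real.pi := by
      rw [EuclideanSpace.volume_ball_fin_two, ENNReal.coe_toNNReal_eq_toReal, ENNReal.toReal_mul,
        ENNReal.toReal_pow, ENNReal.toReal_ofReal (Nat.cast_nonneg n),
        ENNReal.toReal_ofReal Real.pi_pos.le]
    simp only [pow_zero, Nat.factorial_zero, Nat.cast_one, div_one, mul_one, NNReal.coe_mul, hv]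
  have hlim : Tendsto (fun n : ℕ => ENNReal.ofReal (Real.exp (-(r * ((n : ℝ) ^ 2 * Real.pi)))))
      atTop (nhds 0) := by
    rw [← ENNReal.ofReal_zero]
    refine ENNReal.tendsto_ofReal (Real.tendsto_exp_neg_atTop_nhds_zero.comp ?_)
    refine Tendsto.const_mul_atTop (by exact_mod_cast hr) ?_
    refine Tendsto.atTop_mul_const Real.pi_pos ?_
    exact (tendsto_pow_atTop two_ne_zero).comp tendsto_natCast_atTop_atTop
  exact le_antisymm (ge_of_tendsto' hlim hle) zero_le

lemma nullMeasurableSet_of_ae_eventually_iff {E : ℕ → Set Ω} {E' : Set Ω}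
    (hE : ∀ n, MeasurableSet (E n)) (h : ∀ᵐ ω ∂μ, ∀ᶠ n in atTop, ω ∈ E n ↔ ω ∈ E') :
    NullMeasurableSet E' μ := by
  refine (MeasurableSet.nullMeasurableSet (s := ⋃ N, ⋂ n ≥ N, E n) (MeasurableSet.iUnion fun N =>
    MeasurableSet.iInter fun n => MeasurableSet.iInter fun _ => hE n)).congr ?_
  filter_upwards [h] with ω hω
  refine propext (Iff.trans (b := ∀ᶠ n in atTop, ω ∈ E n) ?_ ⟨fun h' => ?_, fun h' => ?_⟩)
  · change ω ∈ (⋃ N, ⋂ n ≥ N, E n) ↔ _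
    simp [eventually_atTop]
  · obtain ⟨n, hn, hn'⟩ := (hω.and h').exists
    exact hn.1 hn'
  · filter_upwards [hω] with n hn using hn.2 h'

/-- Probabilities of events that converge almost surely converge, even if the limit event is not
assumed to be measurable. -/
lemma tendsto_measureReal_of_ae_eventually_iff [IsFiniteMeasure μ] {E : ℕ → Set Ω} {E' : Set Ω}
    (hE : ∀ n, MeasurableSet (E n)) (h : ∀ᵐ ω ∂μ, ∀ᶠ n in atTop, ω ∈ E n ↔ ω ∈ E') :
    Tendsto (fun n => μ.real (E n)) atTop (nhds (μ.real E')) := by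
  have hE' := nullMeasurableSet_of_ae_eventually_iff hE h
  have hae := hE'.toMeasurable_ae_eq
  rw [measureReal_congr hae.symm]
  refine (ENNReal.tendsto_toReal (measure_ne_top _ _)).comp
    (tendsto_measure_of_ae_tendsto_indicator_of_isFiniteMeasure atTop
      (measurableSet_toMeasurable μ E') hE ?_)
  filter_upwards [h, hae] with ω hω hω'
  filter_upwards [hω] with n hn
  exact hn.trans (iff_of_eq hω').symm

/-- The cell partitions along which the Poisson process is discretized. -/
noncomputable def cellPartition (k : ℕ) : CellPartition k := (nonempty_cellPartition k).some

lemma IsColouredPoisson.ae_regular (hZ : IsColouredPoisson μ Zb Zw p) (hp : 0 < p) :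
    ∀ᵐ ω ∂μ, LocallyFinitePoints (Zb ω) ∧ (Zb ω).Nonempty :=
  hZ.black.locallyFinite.and (hZ.black.ae_nonempty (Real.toNNReal_pos.2 hp))

lemma IsColouredPoisson.nullMeasurableSet (hZ : IsColouredPoisson μ Zb Zw p) (hp : 0 < p)
    {Q : Set Plane → Set Plane → Prop} (hQ : ClosedIncreasing Q) :
    NullMeasurableSet {ω | Q (Zb ω) (Zw ω)} μ := by
  refine nullMeasurableSet_of_ae_eventually_iff
    (E := fun k => cells (cellPartition k) Zb Zw ⁻¹' cellEvent (cellPartition k) Q)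
    (fun k => hZ.measurableSet_cells_preimage _ _) ?_
  filter_upwards [hZ.ae_regular hp] with ω hω
  exact hQ.eventually_mem_cellEvent_iff cellPartition hω.1 hω.2

lemma IsColouredPoisson.tendsto_measure_cells [IsFiniteMeasure μ]
    (hZ : IsColouredPoisson μ Zb Zw p) (hp : 0 < p) {Q : Set Plane → Set Plane → Prop}
    (hQ : ClosedIncreasing Q) :
    Tendsto (fun k => μ.real (cells (cellPartition k) Zb Zw ⁻¹' cellEvent (cellPartition k) Q))
      atTop (nhds (μ.real {ω | Q (Zb ω) (Zw ω)})) := by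
  refine tendsto_measureReal_of_ae_eventually_iff
    (fun k => hZ.measurableSet_cells_preimage _ _) ?_
  filter_upwards [hZ.ae_regular hp] with ω hω
  exact hQ.eventually_mem_cellEvent_iff cellPartition hω.1 hω.2

/-- **Harris' inequality** for coloured Poisson processes: closed increasing events are
positively correlated. -/
theorem IsColouredPoisson.measure_mul_le_measure_and [IsProbabilityMeasure μ]
    (hZ : IsColouredPoisson μ Zb Zw p) (hp : 0 < p) {Q Q' : Set Plane → Set Plane → Prop}
    (hQ : ClosedIncreasing Q) (hQ' : ClosedIncreasing Q') :
    μ.real {ω | Q (Zb ω) (Zw ω)} * μ.real {ω | Q' (Zb ω) (Zw ω)}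
      ≤ μ.real {ω | Q (Zb ω) (Zw ω) ∧ Q' (Zb ω) (Zw ω)} := by
  have hlim : Tendsto (fun k => μ.real (cells (cellPartition k) Zb Zw ⁻¹'
      (cellEvent (cellPartition k) Q ∩ cellEvent (cellPartition k) Q'))) atTop
      (nhds (μ.real {ω | Q (Zb ω) (Zw ω) ∧ Q' (Zb ω) (Zw ω)})) := by
    refine tendsto_measureReal_of_ae_eventually_iff
      (fun k => hZ.measurableSet_cells_preimage _ _) ?_
    filter_upwards [hZ.ae_regular hp] with ω hω
    filter_upwards [hQ.eventually_mem_cellEvent_iff cellPartition hω.1 hω.2 (Zw := Zw ω),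
      hQ'.eventually_mem_cellEvent_iff cellPartition hω.1 hω.2 (Zw := Zw ω)] with k h h'
    exact and_congr h h'
  exact le_of_tendsto_of_tendsto'
    ((hZ.tendsto_measure_cells hp hQ).mul (hZ.tendsto_measure_cells hp hQ')) hlim
    fun k => hZ.measure_cells_inter_ge (cellPartition k) Q Q'

/-- The probability of a closed increasing event is determined by `p`. -/
theorem IsColouredPoisson.measure_eq_measure [IsFiniteMeasure μ]
    (hZ : IsColouredPoisson μ Zb Zw p) {Zb' Zw' : Ω → Set Plane}
    (hZ' : IsColouredPoisson μ Zb' Zw' p) (hp : 0 < p) {Q : Set Plane → Set Plane → Prop}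
    (hQ : ClosedIncreasing Q) :
    μ.real {ω | Q (Zb ω) (Zw ω)} = μ.real {ω | Q (Zb' ω) (Zw' ω)} := by
  refine tendsto_nhds_unique (hZ.tendsto_measure_cells hp hQ) ?_
  refine (hZ'.tendsto_measure_cells hp hQ).congr fun k => ?_
  rw [hZ.measure_cells_preimage, hZ'.measure_cells_preimage]

/-! ### Invariance under isometries -/

lemma IsPoissonProcess.image {Z : Ω → Set Plane} {r : ℝ≥0} (hZ : IsPoissonProcess μ Z r)
    (g : Plane ≃ᵃⁱ[ℝ] Plane) (hg : MeasurePreserving g volume volume) :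
    IsPoissonProcess μ (fun ω => g '' Z ω) r where
  locallyFinite := by
    filter_upwards [hZ.locallyFinite] with ω hω B hB
    have : g '' Z ω ∩ B = g '' (Z ω ∩ g ⁻¹' B) := (Set.image_inter_preimage g (Z ω) B).symm
    rw [this]
    exact (hω _ (g.isometry.antilipschitz.isBounded_preimage hB)).image _
  measurable_count B hB := by
    rw [count_image]
    exact hZ.measurable_count _ (hg.measurable hB)
  law_count B hB hv := by
    rw [count_image, hZ.law_count _ (hg.measurable hB)
      (by rwa [hg.measure_preimage hB.nullMeasurableSet]),
      hg.measure_preimage hB.nullMeasurableSet]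
  indep_count n B hB hd := by
    simp only [count_image]
    exact hZ.indep_count n (fun i => g ⁻¹' B i) (fun i => hg.measurable (hB i))
      fun i j hij => (hd hij).preimage g

lemma IsColouredPoisson.image (hZ : IsColouredPoisson μ Zb Zw p) (g : Plane ≃ᵃⁱ[ℝ] Plane)
    (hg : MeasurePreserving g volume volume) :
    IsColouredPoisson μ (fun ω => g '' Zb ω) (fun ω => g '' Zw ω) p where
  black := hZ.black.image g hg
  white := hZ.white.image g hg
  indep := indep_of_indep_of_le_left (indep_of_indep_of_le_right hZ.indep
    (countSigma_image_le g hg Zw)) (countSigma_image_le g hg Zb)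

lemma preimage_blackSet_image (g : Plane ≃ᵃⁱ[ℝ] Plane) (Yb Yw : Set Plane) :
    g ⁻¹' blackSet (g '' Yb) (g '' Yw) = blackSet Yb Yw := by
  ext x
  simp [blackSet]

lemma Conn.image (g : Plane ≃ᵃⁱ[ℝ] Plane) {R S T Yb Yw : Set Plane}
    (h : Conn (g ⁻¹' R) (g ⁻¹' S) (g ⁻¹' T) Yb Yw) : Conn R S T (g '' Yb) (g '' Yw) := by
  obtain ⟨x, hx, y, hy, h⟩ := h
  refine ⟨g x, hx, g y, hy, PLJoined.map g ?_⟩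
  rwa [Set.preimage_inter, preimage_blackSet_image]

/-- The probability that a black path in `R` joins `S` to `T`. -/
noncomputable def connProb (μ : Measure Ω) (Zb Zw : Ω → Set Plane) (R S T : Set Plane) : ℝ :=
  μ.real {ω | Conn R S T (Zb ω) (Zw ω)}

theorem IsColouredPoisson.connProb_preimage_le [IsFiniteMeasure μ]
    (hZ : IsColouredPoisson μ Zb Zw p) (hp : 0 < p) (g : Plane ≃ᵃⁱ[ℝ] Plane)
    (hg : MeasurePreserving g volume volume) {R S T : Set Plane} (hR : IsCompact R)
    (hRc : Convex ℝ R) (hS : IsClosed S) (hT : IsClosed T) :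
    connProb μ Zb Zw (g ⁻¹' R) (g ⁻¹' S) (g ⁻¹' T) ≤ connProb μ Zb Zw R S T := by
  rw [connProb, connProb,
    hZ.measure_eq_measure (hZ.image g hg) hp (closedIncreasing_conn hR hRc hS hT)]
  exact measureReal_mono fun ω hω => Conn.image g hω

end Law

/-! ### Boxes -/

/-- The rectangle `[a, b] × [c, d]`; the sides of rectangles are degenerate boxes. -/
def box (a b c d : ℝ) : Set Plane := {x | x 0 ∈ Set.Icc a b ∧ x 1 ∈ Set.Icc c d}

lemma isClosed_box (a b c d : ℝ) : IsClosed (box a b c d) :=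
  (isClosed_Icc.preimage (by fun_prop : Continuous fun x : Plane => x 0)).inter
    (isClosed_Icc.preimage (by fun_prop : Continuous fun x : Plane => x 1))

lemma isCompact_box (a b c d : ℝ) : IsCompact (box a b c d) := by
  refine Metric.isCompact_of_isClosed_isBounded (isClosed_box a b c d) ?_
  refine (Metric.isBounded_closedBall (x := (0 : Plane))
    (r := √((|a| + |b|) ^ 2 + (|c| + |d|) ^ 2))).subset fun x hx => ?_
  have h0 : |x 0| ≤ |a| + |b| := by
    rw [abs_le]
    constructor <;> linarith [hx.1.1, hx.1.2, neg_abs_le a, le_abs_self b, abs_nonneg a,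
      abs_nonneg b]
  have h1 : |x 1| ≤ |c| + |d| := by
    rw [abs_le]
    constructor <;> linarith [hx.2.1, hx.2.2, neg_abs_le c, le_abs_self d, abs_nonneg c,
      abs_nonneg d]
  rw [mem_closedBall_zero_iff, EuclideanSpace.norm_eq, Fin.sum_univ_two, Real.norm_eq_abs,
    Real.norm_eq_abs]
  gcongr

lemma convex_box (a b c d : ℝ) : Convex ℝ (box a b c d) :=
  ((convex_Icc a b).linear_preimage
      (EuclideanSpace.proj (0 : Fin 2) : Plane →L[ℝ] ℝ).toLinearMap).inter
    ((convex_Icc c d).linear_preimage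
      (EuclideanSpace.proj (1 : Fin 2) : Plane →L[ℝ] ℝ).toLinearMap)

lemma closedIncreasing_conn_box (a b c d a₁ b₁ c₁ d₁ a₂ b₂ c₂ d₂ : ℝ) :
    ClosedIncreasing (Conn (box a b c d) (box a₁ b₁ c₁ d₁) (box a₂ b₂ c₂ d₂)) :=
  closedIncreasing_conn (isCompact_box _ _ _ _) (convex_box _ _ _ _) (isClosed_box _ _ _ _)
    (isClosed_box _ _ _ _)

/-- Reflection of the plane in the axis `x j = 0`. -/
noncomputable def flip (j : Fin 2) : Plane ≃ₗᵢ[ℝ] Plane where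
  toLinearEquiv := LinearEquiv.ofInvolutive
    { toFun := fun x => WithLp.toLp 2 fun i => if i = j then -x i else x i
      map_add' := fun x y => by
        ext i
        by_cases h : i = j <;> simp [h, add_comm]
      map_smul' := fun r x => by
        ext i
        by_cases h : i = j <;> simp [h] }
    (fun x => by
      ext i
      by_cases h : i = j <;> simp [h])
  norm_map' x := by
    simp only [EuclideanSpace.norm_eq]
    congr 1
    refine Finset.sum_congr rfl fun i _ => ?_
    by_cases h : i = j <;> simp [h]

@[simp] lemma flip_apply (j i : Fin 2) (x : Plane) :
    flip j x i = if i = j then -x i else x i := rfl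

/-- Reflection of the plane in the diagonal. -/
noncomputable def transpose : Plane ≃ₗᵢ[ℝ] Plane :=
  LinearIsometryEquiv.piLpCongrLeft 2 ℝ ℝ (Equiv.swap (0 : Fin 2) 1)

@[simp] lemma transpose_apply_zero (x : Plane) : transpose x 0 = x 1 := by
  simp [transpose, LinearIsometryEquiv.piLpCongrLeft_apply, Equiv.piCongrLeft']

@[simp] lemma transpose_apply_one (x : Plane) : transpose x 1 = x 0 := by
  simp [transpose, LinearIsometryEquiv.piLpCongrLeft_apply, Equiv.piCongrLeft']

section Symmetry

variable {Ω : Type*} [MeasurableSpace Ω] {μ : Measure Ω} {Zb Zw : Ω → Set Plane} {p : ℝ}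

lemma IsColouredPoisson.connProb_box_le_of_preimage [IsFiniteMeasure μ]
    (hZ : IsColouredPoisson μ Zb Zw p) (hp : 0 < p) (g : Plane ≃ᵃⁱ[ℝ] Plane)
    (hg : MeasurePreserving g volume volume) {R S T : Set Plane}
    {a b c d a₁ b₁ c₁ d₁ a₂ b₂ c₂ d₂ : ℝ} (hR : g ⁻¹' box a b c d = R)
    (hS : g ⁻¹' box a₁ b₁ c₁ d₁ = S) (hT : g ⁻¹' box a₂ b₂ c₂ d₂ = T) :
    connProb μ Zb Zw R S T
      ≤ connProb μ Zb Zw (box a b c d) (box a₁ b₁ c₁ d₁) (box a₂ b₂ c₂ d₂) := by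
  rw [← hR, ← hS, ← hT]
  exact hZ.connProb_preimage_le hp g hg (isCompact_box _ _ _ _) (convex_box _ _ _ _)
    (isClosed_box _ _ _ _) (isClosed_box _ _ _ _)

lemma IsColouredPoisson.connProb_shift_le [IsFiniteMeasure μ]
    (hZ : IsColouredPoisson μ Zb Zw p) (hp : 0 < p) (u v : ℝ)
    (a b c d a₁ b₁ c₁ d₁ a₂ b₂ c₂ d₂ : ℝ) :
    connProb μ Zb Zw (box a b c d) (box a₁ b₁ c₁ d₁) (box a₂ b₂ c₂ d₂)
      ≤ connProb μ Zb Zw (box (a + u) (b + u) (c + v) (d + v))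
        (box (a₁ + u) (b₁ + u) (c₁ + v) (d₁ + v)) (box (a₂ + u) (b₂ + u) (c₂ + v) (d₂ + v)) := by
  have key : ∀ a b c d : ℝ, (AffineIsometryEquiv.constVAdd ℝ Plane !₂[u, v]) ⁻¹'
      box (a + u) (b + u) (c + v) (d + v) = box a b c d := by
    intro a b c d
    ext x
    simp only [box, Set.mem_preimage, Set.mem_ofPred_eq, AffineIsometryEquiv.coe_constVAdd,
      vadd_eq_add, PiLp.add_apply, Set.mem_Icc]
    simp [add_comm u, add_comm v]
  exact hZ.connProb_box_le_of_preimage hp _ (measurePreserving_add_left volume _)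
    (key _ _ _ _) (key _ _ _ _) (key _ _ _ _)

lemma IsColouredPoisson.connProb_flip_zero_le [IsFiniteMeasure μ]
    (hZ : IsColouredPoisson μ Zb Zw p) (hp : 0 < p)
    (a b c d a₁ b₁ c₁ d₁ a₂ b₂ c₂ d₂ : ℝ) :
    connProb μ Zb Zw (box a b c d) (box a₁ b₁ c₁ d₁) (box a₂ b₂ c₂ d₂)
      ≤ connProb μ Zb Zw (box (-b) (-a) c d) (box (-b₁) (-a₁) c₁ d₁) (box (-b₂) (-a₂) c₂ d₂) := by
  have key : ∀ a b c d : ℝ, (flip 0).toAffineIsometryEquiv ⁻¹' box (-b) (-a) c d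
      = box a b c d := by
    intro a b c d
    ext x
    simp [box, and_comm (a := a ≤ x 0)]
  exact hZ.connProb_box_le_of_preimage hp _ (flip 0).measurePreserving
    (key _ _ _ _) (key _ _ _ _) (key _ _ _ _)

lemma IsColouredPoisson.connProb_flip_one_le [IsFiniteMeasure μ]
    (hZ : IsColouredPoisson μ Zb Zw p) (hp : 0 < p)
    (a b c d a₁ b₁ c₁ d₁ a₂ b₂ c₂ d₂ : ℝ) :
    connProb μ Zb Zw (box a b c d) (box a₁ b₁ c₁ d₁) (box a₂ b₂ c₂ d₂)
      ≤ connProb μ Zb Zw (box a b (-d) (-c)) (box a₁ b₁ (-d₁) (-c₁)) (box a₂ b₂ (-d₂) (-c₂)) := by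
  have key : ∀ a b c d : ℝ, (flip 1).toAffineIsometryEquiv ⁻¹' box a b (-d) (-c)
      = box a b c d := by
    intro a b c d
    ext x
    simp [box, and_comm (a := c ≤ x 1)]
  exact hZ.connProb_box_le_of_preimage hp _ (flip 1).measurePreserving
    (key _ _ _ _) (key _ _ _ _) (key _ _ _ _)

lemma IsColouredPoisson.connProb_transpose_le [IsFiniteMeasure μ]
    (hZ : IsColouredPoisson μ Zb Zw p) (hp : 0 < p)
    (a b c d a₁ b₁ c₁ d₁ a₂ b₂ c₂ d₂ : ℝ) :
    connProb μ Zb Zw (box a b c d) (box a₁ b₁ c₁ d₁) (box a₂ b₂ c₂ d₂)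
      ≤ connProb μ Zb Zw (box c d a b) (box c₁ d₁ a₁ b₁) (box c₂ d₂ a₂ b₂) := by
  have key : ∀ a b c d : ℝ, transpose.toAffineIsometryEquiv ⁻¹' box c d a b
      = box a b c d := by
    intro a b c d
    ext x
    simp [box, and_comm (b := a ≤ x 0 ∧ x 0 ≤ b)]
  exact hZ.connProb_box_le_of_preimage hp _ transpose.measurePreserving
    (key _ _ _ _) (key _ _ _ _) (key _ _ _ _)

end Symmetry

/-! ### Gluing black paths -/

section Gluing

variable {Yb Yw : Set Plane}

/-- In a square crossed vertically and crossed horizontally to two parts of its right-hand side,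
these two parts are joined. -/
lemma Conn.join_right_side {h β : ℝ}
    (h₁ : Conn (box (-h) h (-h) h) (box (-h) (-h) (-h) h) (box h h β h) Yb Yw)
    (h₂ : Conn (box (-h) h (-h) h) (box (-h) (-h) (-h) h) (box h h (-h) (-β)) Yb Yw)
    (h₃ : Conn (box (-h) h (-h) h) (box (-h) h (-h) (-h)) (box (-h) h h h) Yb Yw) :
    Conn (box (-h) h (-h) h) (box h h (-h) (-β)) (box h h β h) Yb Yw := by
  obtain ⟨x, hx, x', hx', hxx⟩ := h₁
  obtain ⟨y, hy, y', hy', hyy⟩ := h₂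
  obtain ⟨v, hv, v', hv', hvv⟩ := h₃
  obtain ⟨z, hz, hvz⟩ := hxx.exists_meet_of_crossing hvv
    (fun z hz => ⟨hx.1.2.trans hz.1.1.1, hz.1.1.2.trans hx'.1.1⟩)
    (fun z hz => ⟨hv.2.2.trans hz.1.2.1, hz.1.2.2.trans hv'.2.1⟩)
  obtain ⟨w, hw, hvw⟩ := hyy.exists_meet_of_crossing hvv
    (fun z hz => ⟨hy.1.2.trans hz.1.1.1, hz.1.1.2.trans hy'.1.1⟩)
    (fun z hz => ⟨hv.2.2.trans hz.1.2.1, hz.1.2.2.trans hv'.2.1⟩)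
  exact ⟨y', hy', x', hx',
    (((hyy.symm.trans hw).trans hvw.symm).trans hvz).trans (hz.symm.trans hxx)⟩

/-- Two paths in overlapping squares, each enclosing the middle two thirds of the right-hand
side, form a long vertical crossing. -/
lemma Conn.stack {k : ℝ} (hk : 0 ≤ k)
    (h₁ : Conn (box (-(3 * k)) (3 * k) (-(3 * k)) (3 * k))
      (box (3 * k) (3 * k) (-(3 * k)) (-(2 * k))) (box (3 * k) (3 * k) (2 * k) (3 * k)) Yb Yw)
    (h₂ : Conn (box (-(3 * k)) (3 * k) k (7 * k))
      (box (3 * k) (3 * k) k (2 * k)) (box (3 * k) (3 * k) (6 * k) (7 * k)) Yb Yw) :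
    Conn (box (-(3 * k)) (3 * k) (-(2 * k)) (6 * k))
      (box (-(3 * k)) (3 * k) (-(2 * k)) (-(2 * k))) (box (-(3 * k)) (3 * k) (6 * k) (6 * k))
      Yb Yw := by
  obtain ⟨x, hx, x', hx', hxx⟩ := h₁
  obtain ⟨y, hy, y', hy', hyy⟩ := h₂
  obtain ⟨z, hz, hyz⟩ := hxx.exists_meet_of_interlaced hyy
    (fun z hz => ⟨hz.1.1.2.trans hx.1.1, hz.1.1.2.trans hx'.1.1⟩)
    (fun z hz => ⟨hz.1.1.2.trans hy.1.1, hz.1.1.2.trans hy'.1.1⟩)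
    (by linarith [hx.2.2, hy.2.1]) (hy.2.2.trans hx'.2.1) (by linarith [hx'.2.2, hy'.2.1])
  have hsub : ∀ c d : ℝ, -(3 * k) ≤ c → d ≤ 7 * k →
      box (-(3 * k)) (3 * k) c d ∩ blackSet Yb Yw
        ⊆ box (-(3 * k)) (3 * k) (-(3 * k)) (7 * k) ∩ blackSet Yb Yw := fun c d hc hd =>
    Set.inter_subset_inter_left _ fun w hw => ⟨hw.1, hc.trans hw.2.1, hw.2.2.trans hd⟩
  have hxy := ((hz.mono (hsub _ _ le_rfl (by linarith))).trans
    (hyz.mono (hsub _ _ (by linarith) le_rfl)).symm).trans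
    (hyy.mono (hsub _ _ (by linarith) le_rfl))
  obtain ⟨u, u', hu, hu', huu⟩ := hxy.exists_strip_crossing 1 (a := -(2 * k)) (b := 6 * k)
    (by linarith) hx.2.2 hy'.2.1
  refine ⟨u, ⟨huu.left_mem.1.1.1, hu.ge, hu.le⟩, u', ⟨huu.right_mem.1.1.1, hu'.ge, hu'.le⟩,
    huu.mono ?_⟩
  rintro w ⟨⟨hw, hwb⟩, hw'⟩
  exact ⟨⟨hw.1, hw'⟩, hwb⟩

/-- A black cluster in a square that encloses the parts `[-q, q]` of the left- and right-hand
sides joins two horizontal paths arriving in these parts from outside the square. -/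
lemma Conn.bridge {k q : ℝ} (hk : 0 ≤ k) (hq : 0 ≤ q) (hqk : q ≤ k)
    (hl : Conn (box (-(4 * k)) (2 * k) (-(3 * k) - q) (3 * k - q))
      (box (-(4 * k)) (-(4 * k)) (-(3 * k) - q) (3 * k - q)) (box (2 * k) (2 * k) (-q) q) Yb Yw)
    (hr : Conn (box (-(2 * k)) (4 * k) (-(3 * k) - q) (3 * k - q))
      (box (4 * k) (4 * k) (-(3 * k) - q) (3 * k - q)) (box (-(2 * k)) (-(2 * k)) (-q) q) Yb Yw)
    (h₁ : Conn (box (-(2 * k)) (2 * k) (-(2 * k)) (2 * k))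
      (box (-(2 * k)) (-(2 * k)) (-(2 * k)) (2 * k)) (box (2 * k) (2 * k) q (2 * k)) Yb Yw)
    (h₂ : Conn (box (-(2 * k)) (2 * k) (-(2 * k)) (2 * k))
      (box (-(2 * k)) (-(2 * k)) (-(2 * k)) (2 * k)) (box (2 * k) (2 * k) (-(2 * k)) (-q)) Yb Yw)
    (h₃ : Conn (box (-(2 * k)) (2 * k) (-(2 * k)) (2 * k))
      (box (2 * k) (2 * k) (-(2 * k)) (2 * k)) (box (-(2 * k)) (-(2 * k)) q (2 * k)) Yb Yw)
    (h₄ : Conn (box (-(2 * k)) (2 * k) (-(2 * k)) (2 * k))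
      (box (2 * k) (2 * k) (-(2 * k)) (2 * k)) (box (-(2 * k)) (-(2 * k)) (-(2 * k)) (-q)) Yb Yw)
    (h₅ : Conn (box (-(2 * k)) (2 * k) (-(2 * k)) (2 * k))
      (box (-(2 * k)) (2 * k) (-(2 * k)) (-(2 * k))) (box (-(2 * k)) (2 * k) (2 * k) (2 * k))
      Yb Yw) :
    Conn (box (-(4 * k)) (4 * k) (-(3 * k) - q) (3 * k - q))
      (box (-(4 * k)) (-(4 * k)) (-(3 * k) - q) (3 * k - q))
      (box (4 * k) (4 * k) (-(3 * k) - q) (3 * k - q)) Yb Yw := by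
  set B := box (-(2 * k)) (2 * k) (-(2 * k)) (2 * k) ∩ blackSet Yb Yw with hB
  obtain ⟨v, hv, v', hv', hvv⟩ := h₅
  -- all horizontal crossings of the small square are joined to its vertical crossing
  have htoV : ∀ {x y : Plane}, PLJoined B x y → x 0 = -(2 * k) → y 0 = 2 * k →
      PLJoined B v x ∧ PLJoined B v y := by
    intro x y hxy hx hy
    obtain ⟨z, hz, hvz⟩ := hxy.exists_meet_of_crossing hvv
      (fun z hz => ⟨hx.le.trans hz.1.1.1, hz.1.1.2.trans hy.ge⟩)
      (fun z hz => ⟨hv.2.2.trans hz.1.2.1, hz.1.2.2.trans hv'.2.1⟩)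
    exact ⟨hvz.trans hz.symm, (hvz.trans hz.symm).trans hxy⟩
  obtain ⟨x₁, hx₁, y₁, hy₁, e₁⟩ := h₁
  obtain ⟨x₂, hx₂, y₂, hy₂, e₂⟩ := h₂
  obtain ⟨x₃, hx₃, y₃, hy₃, e₃⟩ := h₃
  obtain ⟨x₄, hx₄, y₄, hy₄, e₄⟩ := h₄
  have f₁ := (htoV e₁ (le_antisymm hx₁.1.2 hx₁.1.1) (le_antisymm hy₁.1.2 hy₁.1.1)).2
  have f₂ := (htoV e₂ (le_antisymm hx₂.1.2 hx₂.1.1) (le_antisymm hy₂.1.2 hy₂.1.1)).2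
  have f₃ := (htoV e₃.symm (le_antisymm hy₃.1.2 hy₃.1.1) (le_antisymm hx₃.1.2 hx₃.1.1)).1
  have f₄ := (htoV e₄.symm (le_antisymm hy₄.1.2 hy₄.1.1) (le_antisymm hx₄.1.2 hx₄.1.1)).1
  obtain ⟨l, hl, l', hl', ell⟩ := hl
  obtain ⟨r, hr, r', hr', err⟩ := hr
  obtain ⟨z, hz, hyz⟩ := ell.exists_meet_of_enclosed_end one_ne_zero (f₂.symm.trans f₁)
    (fun z hz => by
      constructor <;> linarith [hz.1.1.1, hz.1.1.2, hl.1.2, hl'.1.1])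
    (fun z hz => by
      constructor <;> linarith [hz.1.1.2, hy₁.1.1, hy₂.1.1])
    (hy₂.2.2.trans hl'.2.1) (hl'.2.2.trans hy₁.2.1)
  obtain ⟨w, hw, hyw⟩ := err.exists_meet_of_enclosed_end (σ := -1) (by norm_num)
    (f₄.symm.trans f₃)
    (fun z hz => by
      constructor <;> linarith [hz.1.1.1, hz.1.1.2, hr.1.1, hr'.1.2])
    (fun z hz => by
      constructor <;> linarith [hz.1.1.1, hy₃.1.2, hy₄.1.2])
    (hy₄.2.2.trans hr'.2.1) (hr'.2.2.trans hy₃.2.1)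
  have hsub : ∀ a b c d : ℝ, -(4 * k) ≤ a → b ≤ 4 * k → -(3 * k) - q ≤ c → d ≤ 3 * k - q →
      box a b c d ∩ blackSet Yb Yw
        ⊆ box (-(4 * k)) (4 * k) (-(3 * k) - q) (3 * k - q) ∩ blackSet Yb Yw :=
    fun a b c d ha hb hc hd => Set.inter_subset_inter_left _ fun w hw =>
      ⟨⟨ha.trans hw.1.1, hw.1.2.trans hb⟩, hc.trans hw.2.1, hw.2.2.trans hd⟩
  have hBsub := hsub (-(2 * k)) (2 * k) (-(2 * k)) (2 * k) (by linarith) (by linarith)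
    (by linarith) (by linarith)
  have g₁ := hz.mono (hsub _ _ _ _ le_rfl (by linarith) le_rfl le_rfl)
  have g₂ := (((f₂.trans hyz).symm.trans f₄).trans hyw).mono hBsub
  have g₃ := hw.symm.mono (hsub _ _ _ _ (by linarith) le_rfl le_rfl le_rfl)
  exact ⟨l, hl, r, hr, (g₁.trans g₂).trans g₃⟩

/-- Horizontal crossings of two rectangles overlapping in a square are joined by a vertical
crossing of the square. -/
lemma Conn.extend {L d s : ℝ} (hs : s ≤ L) (hd : 0 ≤ d)
    (h₁ : Conn (box 0 L 0 s) (box 0 0 0 s) (box L L 0 s) Yb Yw)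
    (h₂ : Conn (box (L - s) (L + d) 0 s) (box (L - s) (L - s) 0 s) (box (L + d) (L + d) 0 s) Yb Yw)
    (h₃ : Conn (box (L - s) L 0 s) (box (L - s) L 0 0) (box (L - s) L s s) Yb Yw) :
    Conn (box 0 (L + d) 0 s) (box 0 0 0 s) (box (L + d) (L + d) 0 s) Yb Yw := by
  obtain ⟨x, hx, x', hx', hxx⟩ := h₁
  obtain ⟨y, hy, y', hy', hyy⟩ := h₂
  obtain ⟨v, hv, v', hv', hvv⟩ := h₃
  obtain ⟨z, hz, hvz⟩ := hxx.exists_meet_of_crossing hvv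
    (fun z hz => ⟨by linarith [hx.1.2, hz.1.1.1], hz.1.1.2.trans hx'.1.1⟩)
    (fun z hz => ⟨hv.2.2.trans hz.1.2.1, hz.1.2.2.trans hv'.2.1⟩)
  obtain ⟨w, hw, hvw⟩ := hyy.exists_meet_of_crossing hvv
    (fun z hz => ⟨hy.1.2.trans hz.1.1.1, by linarith [hz.1.1.2, hy'.1.1]⟩)
    (fun z hz => ⟨hv.2.2.trans hz.1.2.1, hz.1.2.2.trans hv'.2.1⟩)
  have hsub : ∀ a b : ℝ, 0 ≤ a → b ≤ L + d →
      box a b 0 s ∩ blackSet Yb Yw ⊆ box 0 (L + d) 0 s ∩ blackSet Yb Yw :=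
    fun a b ha hb => Set.inter_subset_inter_left _ fun w hw =>
      ⟨⟨ha.trans hw.1.1, hw.1.2.trans hb⟩, hw.2⟩
  have g₁ := hz.mono (hsub _ _ le_rfl (by linarith))
  have g₂ := (hvz.symm.trans hvw).mono (hsub _ _ (by linarith) (by linarith))
  have g₃ := (hw.symm.trans hyy).mono (hsub _ _ (by linarith) le_rfl)
  exact ⟨x, hx, y', hy', (g₁.trans g₂).trans g₃⟩

lemma Conn.shorten {L L' s : ℝ} (hL : 0 ≤ L) (hLL : L ≤ L')
    (h : Conn (box 0 L' 0 s) (box 0 0 0 s) (box L' L' 0 s) Yb Yw) :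
    Conn (box 0 L 0 s) (box 0 0 0 s) (box L L 0 s) Yb Yw := by
  obtain ⟨x, hx, y, hy, h⟩ := h
  obtain ⟨u, u', hu, hu', huu⟩ := h.exists_strip_crossing 0 (a := 0) (b := L) hL hx.1.2
    (hLL.trans hy.1.1)
  refine ⟨u, ⟨⟨hu.ge, hu.le⟩, huu.left_mem.1.1.2⟩, u', ⟨⟨hu'.ge, hu'.le⟩, huu.right_mem.1.1.2⟩,
    huu.mono ?_⟩
  rintro w ⟨⟨hw, hwb⟩, hw'⟩
  exact ⟨⟨hw', hw.2⟩, hwb⟩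

end Gluing

section RSW

variable {Ω : Type*} [MeasurableSpace Ω] {μ : Measure Ω}
  {Zb Zw : Ω → Set Plane} {p : ℝ}

/-! ### Crossing probabilities -/

/-- The probability that `[0, L] × [0, s]` has a horizontal black crossing. -/
noncomputable def crossProb (μ : Measure Ω) (Zb Zw : Ω → Set Plane) (L s : ℝ) : ℝ :=
  connProb μ Zb Zw (box 0 L 0 s) (box 0 0 0 s) (box L L 0 s)

/-- The probability that in the square `[-h, h]²` the left-hand side is joined to the part
`{h} × [β, γ]` of the right-hand side by a black path. -/
noncomputable def sideProb (μ : Measure Ω) (Zb Zw : Ω → Set Plane) (h β γ : ℝ) : ℝ :=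
  connProb μ Zb Zw (box (-h) h (-h) h) (box (-h) (-h) (-h) h) (box h h β γ)

lemma hasHorizontalCrossing_blackRegion_iff {Yb Yw : Set Plane} (hb : LocallyFinitePoints Yb)
    {L s : ℝ} (hL : L ≠ 0) : HasHorizontalCrossing (blackRegion Yb Yw) L s ↔
      Conn (box 0 L 0 s) (box 0 0 0 s) (box L L 0 s) Yb Yw := by
  rw [hasHorizontalCrossing_iff hL, blackRegion_eq_blackSet hb]
  constructor
  · rintro ⟨x, y, hx, hy, h⟩
    exact ⟨x, ⟨⟨hx.ge, hx.le⟩, h.left_mem.1.2⟩, y, ⟨⟨hy.ge, hy.le⟩, h.right_mem.1.2⟩, h⟩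
  · rintro ⟨x, hx, y, hy, h⟩
    exact ⟨x, y, le_antisymm hx.1.2 hx.1.1, le_antisymm hy.1.2 hy.1.1, h⟩

/-- The least height `a` such that the left-hand side of `[-h, h]²` is joined to `{h} × [0, a]`
with probability at least `c / 4`. -/
noncomputable def threshold (μ : Measure Ω) (Zb Zw : Ω → Set Plane) (c h : ℝ) : ℝ :=
  sInf {a | 0 ≤ a ∧ a ≤ h ∧ c / 4 ≤ sideProb μ Zb Zw h 0 a}

lemma threshold_nonneg (c h : ℝ) : 0 ≤ threshold μ Zb Zw c h :=
  Real.sInf_nonneg fun _ ha => ha.1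

lemma threshold_le {c h : ℝ} (hc : 0 ≤ c) (hh : 0 ≤ h) (hs : c / 2 ≤ sideProb μ Zb Zw h 0 h) :
    threshold μ Zb Zw c h ≤ h :=
  csInf_le ⟨0, fun _ ha => ha.1⟩ ⟨hh, le_rfl, by linarith⟩

lemma connProb_nonneg (R S T : Set Plane) : 0 ≤ connProb μ Zb Zw R S T := measureReal_nonneg

variable [IsProbabilityMeasure μ]

lemma IsColouredPoisson.crossingProb_eq (hZ : IsColouredPoisson μ Zb Zw p) {ρ s : ℝ}
    (hρs : ρ * s ≠ 0) :
    crossingProb μ Zb Zw ρ s = ENNReal.ofReal (crossProb μ Zb Zw (ρ * s) s) := by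
  rw [crossProb, connProb, ofReal_measureReal]
  refine measure_congr ?_
  filter_upwards [hZ.black.locallyFinite] with ω hω
  exact propext (hasHorizontalCrossing_blackRegion_iff hω hρs)

lemma connProb_mono {R S T R' S' T' : Set Plane} (hR : R ⊆ R') (hS : S ∩ R ⊆ S')
    (hT : T ∩ R ⊆ T') : connProb μ Zb Zw R S T ≤ connProb μ Zb Zw R' S' T' :=
  measureReal_mono fun _ hω => Conn.mono hω hR hS hT

/-- Harris' inequality, for lower bounds on the probabilities of two events. -/
lemma IsColouredPoisson.mul_le_measure_and (hZ : IsColouredPoisson μ Zb Zw p) (hp : 0 < p)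
    {Q Q' : Set Plane → Set Plane → Prop} (hQ : ClosedIncreasing Q) (hQ' : ClosedIncreasing Q')
    {a b : ℝ} (hb : 0 ≤ b) (ha : a ≤ μ.real {ω | Q (Zb ω) (Zw ω)})
    (hb' : b ≤ μ.real {ω | Q' (Zb ω) (Zw ω)}) :
    a * b ≤ μ.real {ω | Q (Zb ω) (Zw ω) ∧ Q' (Zb ω) (Zw ω)} :=
  (mul_le_mul ha hb' hb measureReal_nonneg).trans (hZ.measure_mul_le_measure_and hp hQ hQ')

lemma sideProb_mono (h : ℝ) {β γ β' γ' : ℝ} (hβ : β' ≤ β) (hγ : γ ≤ γ') :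
    sideProb μ Zb Zw h β γ ≤ sideProb μ Zb Zw h β' γ' :=
  connProb_mono subset_rfl Set.inter_subset_left fun _ hx =>
    ⟨hx.1.1, hβ.trans hx.1.2.1, hx.1.2.2.trans hγ⟩

lemma sideProb_le_add (h β γ δ : ℝ) :
    sideProb μ Zb Zw h β δ ≤ sideProb μ Zb Zw h β γ + sideProb μ Zb Zw h γ δ := by
  refine (measureReal_mono fun ω hω => ?_).trans (measureReal_union_le _ _)
  obtain ⟨x, hx, y, hy, hxy⟩ := hω
  rcases le_total (y 1) γ with hγ | hγ
  · exact Or.inl ⟨x, hx, y, ⟨hy.1, hy.2.1, hγ⟩, hxy⟩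
  · exact Or.inr ⟨x, hx, y, ⟨hy.1, hγ, hy.2.2⟩, hxy⟩

lemma IsColouredPoisson.sideProb_le_neg (hZ : IsColouredPoisson μ Zb Zw p) (hp : 0 < p)
    (h β γ : ℝ) : sideProb μ Zb Zw h β γ ≤ sideProb μ Zb Zw h (-γ) (-β) := by
  have := hZ.connProb_flip_one_le hp (-h) h (-h) h (-h) (-h) (-h) h h h β γ
  rwa [neg_neg] at this

lemma IsColouredPoisson.crossProb_le_sideProb (hZ : IsColouredPoisson μ Zb Zw p) (hp : 0 < p)
    (h : ℝ) : crossProb μ Zb Zw (2 * h) (2 * h) ≤ sideProb μ Zb Zw h (-h) h := by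
  have := hZ.connProb_shift_le hp (-h) (-h) 0 (2 * h) 0 (2 * h) 0 0 0 (2 * h) (2 * h) (2 * h) 0
    (2 * h)
  rw [zero_add, show 2 * h + -h = h by ring] at this
  exact this

lemma IsColouredPoisson.half_le_sideProb (hZ : IsColouredPoisson μ Zb Zw p) (hp : 0 < p)
    {c h : ℝ} (hc : c ≤ sideProb μ Zb Zw h (-h) h) : c / 2 ≤ sideProb μ Zb Zw h 0 h := by
  have h1 := sideProb_le_add (μ := μ) (Zb := Zb) (Zw := Zw) h (-h) 0 h
  have h2 := hZ.sideProb_le_neg hp h (-h) 0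
  rw [neg_neg, neg_zero] at h2
  linarith

/-- The probability to reach `{h} × [β, γ]` is continuous from the right in `γ`. -/
lemma IsColouredPoisson.le_sideProb_of_forall (hZ : IsColouredPoisson μ Zb Zw p) (hp : 0 < p)
    {c h β γ : ℝ} (hc : ∀ δ > γ, c ≤ sideProb μ Zb Zw h β δ) :
    c ≤ sideProb μ Zb Zw h β γ := by
  let R := box (-h) h (-h) h
  let S := box (-h) (-h) (-h) h
  let T : ℕ → Set Plane := fun n => box h h β (γ + 1 / ((n : ℝ) + 1))
  have hTa : Antitone T := fun m n hmn x hx =>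
    ⟨hx.1, hx.2.1, hx.2.2.trans (by
      have : 1 / ((n : ℝ) + 1) ≤ 1 / ((m : ℝ) + 1) :=
        one_div_le_one_div_of_le (by positivity) (by gcongr)
      linarith)⟩
  have hTi : ⋂ n, T n = box h h β γ := by
    apply Set.Subset.antisymm
    · intro x hx
      rw [Set.mem_iInter] at hx
      refine ⟨(hx 0).1, (hx 0).2.1, ?_⟩
      have hlim : Tendsto (fun n : ℕ => γ + 1 / ((n : ℝ) + 1)) atTop (nhds (γ + 0)) :=
        tendsto_const_nhds.add (tendsto_one_div_add_atTop_nhds_zero_nat (𝕜 := ℝ))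
      rw [add_zero] at hlim
      exact ge_of_tendsto' hlim fun n => (hx n).2.2
    · refine Set.subset_iInter fun n x hx => ⟨hx.1, hx.2.1, hx.2.2.trans ?_⟩
      have : (0 : ℝ) < 1 / ((n : ℝ) + 1) := by positivity
      linarith
  have hlim : Tendsto (fun n => μ.real {ω | Conn R S (T n) (Zb ω) (Zw ω)}) atTop
      (nhds (μ.real (⋂ n, {ω | Conn R S (T n) (Zb ω) (Zw ω)}))) := by
    refine (ENNReal.tendsto_toReal (measure_ne_top _ _)).comp
      (tendsto_measure_iInter_atTop (fun n => ?_) ?_ ⟨0, measure_ne_top _ _⟩)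
    · exact hZ.nullMeasurableSet hp (closedIncreasing_conn_box _ _ _ _ _ _ _ _ _ _ _ _)
    · exact fun m n hmn ω hω => Conn.mono hω subset_rfl Set.inter_subset_left
        (Set.inter_subset_left.trans (hTa hmn))
  have hlimit : c ≤ μ.real (⋂ n, {ω | Conn R S (T n) (Zb ω) (Zw ω)}) :=
    ge_of_tendsto' hlim fun n => hc _ (by
      have : (0 : ℝ) < 1 / ((n : ℝ) + 1) := by positivity
      linarith)
  refine hlimit.trans (ENNReal.toReal_mono (measure_ne_top _ _) (measure_mono_ae ?_))
  filter_upwards [hZ.black.locallyFinite] with ω hω hmem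
  have hmem' : ∀ n, Conn R S (T n) (Zb ω) (Zw ω) := Set.mem_iInter.1 hmem
  have := Conn.iInter (isCompact_box _ _ _ _) (convex_box _ _ _ _) hω
    (fun n => isClosed_box _ _ _ _) hTa hmem'
  rwa [hTi] at this

/-! ### The threshold height -/

lemma IsColouredPoisson.le_sideProb_threshold (hZ : IsColouredPoisson μ Zb Zw p) (hp : 0 < p)
    {c h : ℝ} (hc : 0 ≤ c) (hh : 0 ≤ h) (hs : c / 2 ≤ sideProb μ Zb Zw h 0 h) :
    c / 4 ≤ sideProb μ Zb Zw h 0 (threshold μ Zb Zw c h) := by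
  refine hZ.le_sideProb_of_forall hp fun δ hδ => ?_
  obtain ⟨a, ha, haδ⟩ := exists_lt_of_csInf_lt (s := {a | 0 ≤ a ∧ a ≤ h ∧
    c / 4 ≤ sideProb μ Zb Zw h 0 a}) ⟨h, hh, le_rfl, by linarith⟩ hδ
  exact ha.2.2.trans (sideProb_mono h le_rfl haδ.le)

/-- Below the threshold, the upper part of the right-hand side is reached. -/
lemma le_sideProb_of_lt_threshold {c h a : ℝ} (hs : c / 2 ≤ sideProb μ Zb Zw h 0 h)
    (ha : 0 ≤ a) (hah : a ≤ h) (hat : a < threshold μ Zb Zw c h) :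
    c / 4 ≤ sideProb μ Zb Zw h a h := by
  have h1 : ¬ c / 4 ≤ sideProb μ Zb Zw h 0 a := fun hcon => by
    have : threshold μ Zb Zw c h ≤ a := csInf_le ⟨0, fun _ hb => hb.1⟩ ⟨ha, hah, hcon⟩
    exact absurd hat (not_lt.2 this)
  have h2 := sideProb_le_add (μ := μ) (Zb := Zb) (Zw := Zw) h 0 a h
  push Not at h1
  linarith

/-- A function bounded by the scale `h` at large scales is, at arbitrarily large scales, zero or
less than twice its value at the scale smaller by the factor `2 / 3`: otherwise it would grow
faster than the scale itself. -/
lemma exists_eq_zero_or_lt_two_mul {α : ℝ → ℝ} {h₀ : ℝ} (hα : ∀ h ≥ h₀, α h ≤ h)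
    (hα0 : ∀ h, 0 ≤ α h) (N : ℝ) :
    ∃ h ≥ N, α h = 0 ∨ α h < 2 * α (2 / 3 * h) := by
  by_contra hcon
  push Not at hcon
  set H := max 1 (max N h₀) with hH
  have hH1 : 1 ≤ H := le_max_left _ _
  have hHN : N ≤ H := (le_max_left _ _).trans (le_max_right _ _)
  have hH0 : h₀ ≤ H := (le_max_right _ _).trans (le_max_right _ _)
  have hge : ∀ n : ℕ, H ≤ (3 / 2) ^ n * H := fun n =>
    le_mul_of_one_le_left (by linarith) (one_le_pow₀ (by norm_num))
  have hpos : 0 < α H := lt_of_le_of_ne (hα0 H) (Ne.symm (hcon H hHN).1)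
  have hgrow : ∀ n : ℕ, 2 ^ n * α H ≤ α ((3 / 2) ^ n * H) := by
    intro n
    induction n with
    | zero => simp
    | succ n ih =>
      have := (hcon ((3 / 2) ^ (n + 1) * H) (hHN.trans (hge _))).2
      rw [show 2 / 3 * ((3 / 2) ^ (n + 1) * H) = (3 / 2 : ℝ) ^ n * H by ring] at this
      calc 2 ^ (n + 1) * α H = 2 * (2 ^ n * α H) := by ring
        _ ≤ 2 * α ((3 / 2) ^ n * H) := by linarith
        _ ≤ _ := this
  obtain ⟨n, hn⟩ := pow_unbounded_of_one_lt (H / α H) (by norm_num : (1 : ℝ) < 4 / 3)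
  rw [div_lt_iff₀ hpos] at hn
  have h1 := (hgrow n).trans (hα _ (hH0.trans (hge n)))
  have h2 : (2 : ℝ) ^ n = (3 / 2) ^ n * (4 / 3) ^ n := by
    rw [← mul_pow]
    norm_num
  rw [h2, mul_assoc] at h1
  have h3 := le_of_mul_le_mul_left h1 (by positivity)
  linarith

/-! ### Crossings of rectangles longer than wide -/

lemma IsColouredPoisson.le_vertical (hZ : IsColouredPoisson μ Zb Zw p) (hp : 0 < p) (h : ℝ) :
    sideProb μ Zb Zw h (-h) h ≤ connProb μ Zb Zw (box (-h) h (-h) h) (box (-h) h (-h) (-h))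
      (box (-h) h h h) :=
  hZ.connProb_transpose_le hp _ _ _ _ _ _ _ _ _ _ _ _

/-- A large threshold leads to long crossings, by stacking two squares. -/
lemma IsColouredPoisson.le_crossProb_of_large_threshold (hZ : IsColouredPoisson μ Zb Zw p)
    (hp : 0 < p) {c k : ℝ} (hc : 0 ≤ c) (hk : 0 ≤ k)
    (h₁ : c ≤ sideProb μ Zb Zw (3 * k) (-(3 * k)) (3 * k))
    (h₂ : c / 4 ≤ sideProb μ Zb Zw (3 * k) (2 * k) (3 * k)) :
    (c / 4 * (c / 4 * c)) * (c / 4 * (c / 4 * c)) ≤ crossProb μ Zb Zw (8 * k) (6 * k) := by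
  have hC := closedIncreasing_conn_box
  have hc4 : 0 ≤ c / 4 := by linarith
  have hU : c / 4 * (c / 4 * c) ≤ connProb μ Zb Zw (box (-(3 * k)) (3 * k) (-(3 * k)) (3 * k))
      (box (3 * k) (3 * k) (-(3 * k)) (-(2 * k))) (box (3 * k) (3 * k) (2 * k) (3 * k)) := by
    refine (hZ.mul_le_measure_and hp (hC _ _ _ _ _ _ _ _ _ _ _ _)
      ((hC _ _ _ _ _ _ _ _ _ _ _ _).and (hC _ _ _ _ _ _ _ _ _ _ _ _)) (by positivity) h₂
      (hZ.mul_le_measure_and hp (hC _ _ _ _ _ _ _ _ _ _ _ _) (hC _ _ _ _ _ _ _ _ _ _ _ _) hc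
        (h₂.trans (hZ.sideProb_le_neg hp _ _ _)) (h₁.trans (hZ.le_vertical hp _)))).trans ?_
    exact measureReal_mono fun ω hω => Conn.join_right_side hω.1 hω.2.1 hω.2.2
  have hU' : c / 4 * (c / 4 * c) ≤ connProb μ Zb Zw (box (-(3 * k)) (3 * k) k (7 * k))
      (box (3 * k) (3 * k) k (2 * k)) (box (3 * k) (3 * k) (6 * k) (7 * k)) := by
    refine hU.trans ((hZ.connProb_shift_le hp 0 (4 * k) _ _ _ _ _ _ _ _ _ _ _ _).trans_eq ?_)
    congr 2 <;> ring
  have hV := (hZ.mul_le_measure_and hp (hC _ _ _ _ _ _ _ _ _ _ _ _)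
    (hC _ _ _ _ _ _ _ _ _ _ _ _) (by positivity) hU hU').trans
    (measureReal_mono fun ω hω => Conn.stack hk hω.1 hω.2)
  refine hV.trans ((hZ.connProb_transpose_le hp _ _ _ _ _ _ _ _ _ _ _ _).trans
    ((hZ.connProb_shift_le hp (2 * k) (3 * k) _ _ _ _ _ _ _ _ _ _ _ _).trans_eq ?_))
  rw [crossProb]
  congr 2 <;> ring

/-- A threshold less than twice the one at the scale smaller by the factor `2 / 3` leads to long
crossings: two paths ending near the middle of a side run into an enclosing cluster in the smaller
square. -/
lemma IsColouredPoisson.le_crossProb_of_enclosing (hZ : IsColouredPoisson μ Zb Zw p)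
    (hp : 0 < p) {c k q : ℝ} (hc : 0 ≤ c) (hq : 0 ≤ q) (hqk : q ≤ k)
    (h₁ : c ≤ sideProb μ Zb Zw (2 * k) (-(2 * k)) (2 * k))
    (h₂ : c / 4 ≤ sideProb μ Zb Zw (2 * k) q (2 * k))
    (h₃ : c / 4 ≤ sideProb μ Zb Zw (3 * k) 0 (2 * q)) :
    c / 4 * (c / 4 * (c / 4 * (c / 4 * (c / 4 * (c / 4 * c)))))
      ≤ crossProb μ Zb Zw (8 * k) (6 * k) := by
  have hC := closedIncreasing_conn_box
  have hk : 0 ≤ k := hq.trans hqk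
  have hc4 : 0 ≤ c / 4 := by linarith
  have hl : c / 4 ≤ connProb μ Zb Zw (box (-(4 * k)) (2 * k) (-(3 * k) - q) (3 * k - q))
      (box (-(4 * k)) (-(4 * k)) (-(3 * k) - q) (3 * k - q)) (box (2 * k) (2 * k) (-q) q) := by
    refine h₃.trans ((hZ.connProb_shift_le hp (-k) (-q) _ _ _ _ _ _ _ _ _ _ _ _).trans_eq ?_)
    congr 2 <;> ring
  have hr : c / 4 ≤ connProb μ Zb Zw (box (-(2 * k)) (4 * k) (-(3 * k) - q) (3 * k - q))
      (box (4 * k) (4 * k) (-(3 * k) - q) (3 * k - q)) (box (-(2 * k)) (-(2 * k)) (-q) q) := by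
    refine hl.trans ((hZ.connProb_flip_zero_le hp _ _ _ _ _ _ _ _ _ _ _ _).trans_eq ?_)
    simp only [neg_neg]
  have hx₂ := h₂.trans (hZ.sideProb_le_neg hp (2 * k) q (2 * k))
  have hx₃ := h₂.trans (hZ.connProb_flip_zero_le hp _ _ _ _ _ _ _ _ _ _ _ _)
  have hx₄ := hx₂.trans (hZ.connProb_flip_zero_le hp _ _ _ _ _ _ _ _ _ _ _ _)
  have hx₅ := h₁.trans (hZ.le_vertical hp _)
  simp only [neg_neg] at hx₃ hx₄
  have q₅ := hC (-(2 * k)) (2 * k) (-(2 * k)) (2 * k) (-(2 * k)) (2 * k) (-(2 * k)) (-(2 * k))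
    (-(2 * k)) (2 * k) (2 * k) (2 * k)
  have q₄ := hC (-(2 * k)) (2 * k) (-(2 * k)) (2 * k) (2 * k) (2 * k) (-(2 * k)) (2 * k)
    (-(2 * k)) (-(2 * k)) (-(2 * k)) (-q)
  have q₃ := hC (-(2 * k)) (2 * k) (-(2 * k)) (2 * k) (2 * k) (2 * k) (-(2 * k)) (2 * k)
    (-(2 * k)) (-(2 * k)) q (2 * k)
  have q₂ := hC (-(2 * k)) (2 * k) (-(2 * k)) (2 * k) (-(2 * k)) (-(2 * k)) (-(2 * k)) (2 * k)
    (2 * k) (2 * k) (-(2 * k)) (-q)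
  have q₁ := hC (-(2 * k)) (2 * k) (-(2 * k)) (2 * k) (-(2 * k)) (-(2 * k)) (-(2 * k)) (2 * k)
    (2 * k) (2 * k) q (2 * k)
  have e₄ := hZ.mul_le_measure_and hp q₄ q₅ hc hx₄ hx₅
  have e₃ := hZ.mul_le_measure_and hp q₃ (q₄.and q₅) (by positivity) hx₃ e₄
  have e₂ := hZ.mul_le_measure_and hp q₂ (q₃.and (q₄.and q₅)) (by positivity) hx₂ e₃
  have e₁ := hZ.mul_le_measure_and hp q₁ (q₂.and (q₃.and (q₄.and q₅))) (by positivity) h₂ e₂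
  have er := hZ.mul_le_measure_and hp (hC _ _ _ _ _ _ _ _ _ _ _ _)
    (q₁.and (q₂.and (q₃.and (q₄.and q₅)))) (by positivity) hr e₁
  have el := hZ.mul_le_measure_and hp (hC _ _ _ _ _ _ _ _ _ _ _ _)
    ((hC _ _ _ _ _ _ _ _ _ _ _ _).and (q₁.and (q₂.and (q₃.and (q₄.and q₅)))))
    (by positivity) hl er
  have hV := el.trans (measureReal_mono fun ω hω =>
    Conn.bridge hk hq hqk hω.1 hω.2.1 hω.2.2.1 hω.2.2.2.1 hω.2.2.2.2.1 hω.2.2.2.2.2.1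
      hω.2.2.2.2.2.2)
  refine hV.trans ((hZ.connProb_shift_le hp (4 * k) (3 * k + q) _ _ _ _ _ _ _ _ _ _ _ _).trans_eq
    ?_)
  rw [crossProb]
  congr 2 <;> ring

/-- Crossings of a rectangle and of a shorter one, overlapping in a square, make a longer
crossing. -/
lemma IsColouredPoisson.crossProb_add_ge (hZ : IsColouredPoisson μ Zb Zw p) (hp : 0 < p)
    {L d s : ℝ} (hs : s ≤ L) (hd : 0 ≤ d) :
    crossProb μ Zb Zw L s * (crossProb μ Zb Zw (s + d) s * crossProb μ Zb Zw s s)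
      ≤ crossProb μ Zb Zw (L + d) s := by
  have hC := closedIncreasing_conn_box
  have h₂ : crossProb μ Zb Zw (s + d) s ≤ connProb μ Zb Zw (box (L - s) (L + d) 0 s)
      (box (L - s) (L - s) 0 s) (box (L + d) (L + d) 0 s) := by
    refine (hZ.connProb_shift_le hp (L - s) 0 _ _ _ _ _ _ _ _ _ _ _ _).trans_eq ?_
    congr 2 <;> ring
  have h₃ : crossProb μ Zb Zw s s ≤ connProb μ Zb Zw (box (L - s) L 0 s)
      (box (L - s) L 0 0) (box (L - s) L s s) := by
    refine (hZ.connProb_transpose_le hp _ _ _ _ _ _ _ _ _ _ _ _).trans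
      ((hZ.connProb_shift_le hp (L - s) 0 _ _ _ _ _ _ _ _ _ _ _ _).trans_eq ?_)
    congr 2 <;> ring
  exact (hZ.mul_le_measure_and hp (hC _ _ _ _ _ _ _ _ _ _ _ _)
    ((hC _ _ _ _ _ _ _ _ _ _ _ _).and (hC _ _ _ _ _ _ _ _ _ _ _ _))
    (mul_nonneg (connProb_nonneg _ _ _) (connProb_nonneg _ _ _)) le_rfl
    (hZ.mul_le_measure_and hp (hC _ _ _ _ _ _ _ _ _ _ _ _) (hC _ _ _ _ _ _ _ _ _ _ _ _)
      (connProb_nonneg _ _ _) h₂ h₃)).trans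
    (measureReal_mono fun ω hω => Conn.extend hs hd hω.1 hω.2.1 hω.2.2)

lemma IsColouredPoisson.crossProb_iterate_ge (hZ : IsColouredPoisson μ Zb Zw p) (hp : 0 < p)
    {c m d s : ℝ} (hc : 0 ≤ c) (hm : 0 ≤ m) (hs : c ≤ crossProb μ Zb Zw s s)
    (hd : 0 ≤ d) (hsd : m ≤ crossProb μ Zb Zw (s + d) s) (n : ℕ) :
    c * (m * c) ^ n ≤ crossProb μ Zb Zw (s + n * d) s := by
  induction n with
  | zero => simpa using hs
  | succ n ih =>
    have h0 : s ≤ s + n * d := by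
      have : 0 ≤ n * d := by positivity
      linarith
    have := hZ.crossProb_add_ge hp h0 hd
    rw [show s + (n : ℝ) * d + d = s + ((n + 1 : ℕ) : ℝ) * d by push_cast; ring] at this
    refine le_trans ?_ this
    rw [pow_succ, ← mul_assoc]
    exact mul_le_mul ih (mul_le_mul hsd hs hc (connProb_nonneg _ _ _)) (by positivity)
      (connProb_nonneg _ _ _)

lemma crossProb_anti {L L' : ℝ} (hL : 0 ≤ L) (hLL : L ≤ L') (s : ℝ) :
    crossProb μ Zb Zw L' s ≤ crossProb μ Zb Zw L s :=
  measureReal_mono fun _ hω => Conn.shorten hL hLL hω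

/-- If squares are crossed with probability at least `c`, then at arbitrarily large scales
rectangles of ratio `4 : 3` are crossed with probability bounded below. -/
lemma IsColouredPoisson.exists_crossProb_ge (hZ : IsColouredPoisson μ Zb Zw p) (hp : 0 < p)
    {c s₀ : ℝ} (hc : 0 < c) (hsq : ∀ s ≥ s₀, c ≤ crossProb μ Zb Zw s s) :
    ∃ m > 0, ∀ N : ℝ, ∃ s ≥ N, m ≤ crossProb μ Zb Zw (s + s / 3) s := by
  refine ⟨min ((c / 4 * (c / 4 * c)) * (c / 4 * (c / 4 * c)))
    (c / 4 * (c / 4 * (c / 4 * (c / 4 * (c / 4 * (c / 4 * c)))))), by positivity, fun N => ?_⟩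
  have hfull : ∀ h, s₀ ≤ 2 * h → c ≤ sideProb μ Zb Zw h (-h) h := fun h hh =>
    (hsq _ hh).trans (hZ.crossProb_le_sideProb hp h)
  have hhalf : ∀ h, s₀ ≤ 2 * h → c / 2 ≤ sideProb μ Zb Zw h 0 h := fun h hh =>
    hZ.half_le_sideProb hp (hfull h hh)
  obtain ⟨h, hhN, hgood⟩ := exists_eq_zero_or_lt_two_mul (α := threshold μ Zb Zw c)
    (h₀ := max 0 s₀)
    (fun h hh => threshold_le hc.le ((le_max_left _ _).trans hh)
      (hhalf h (by linarith [(le_max_left 0 s₀).trans hh, (le_max_right 0 s₀).trans hh])))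
    (fun h => threshold_nonneg c h) (max N (max 0 (2 * s₀)))
  have hN : N ≤ h := (le_max_left _ _).trans hhN
  have h0 : 0 ≤ h := ((le_max_left _ _).trans (le_max_right _ _)).trans hhN
  have hs₀ : 2 * s₀ ≤ h := ((le_max_right _ _).trans (le_max_right _ _)).trans hhN
  obtain ⟨k, rfl⟩ : ∃ k, h = 3 * k := ⟨h / 3, by ring⟩
  have hk : 0 ≤ k := by linarith
  rw [show 2 / 3 * (3 * k) = 2 * k by ring] at hgood
  refine ⟨6 * k, by linarith, ?_⟩
  rw [show 6 * k + 6 * k / 3 = 8 * k by ring]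
  rcases lt_or_ge (2 * k) (threshold μ Zb Zw c (3 * k)) with hlt | hle
  · exact (min_le_left _ _).trans (hZ.le_crossProb_of_large_threshold hp hc.le hk
      (hfull _ (by linarith)) (le_sideProb_of_lt_threshold (hhalf _ (by linarith)) (by linarith)
        (by linarith) hlt))
  · have hq0 := threshold_nonneg (μ := μ) (Zb := Zb) (Zw := Zw) c (3 * k)
    refine (min_le_right _ _).trans (hZ.le_crossProb_of_enclosing hp hc.le
      (q := threshold μ Zb Zw c (3 * k) / 2) (by linarith) (by linarith)
      (hfull _ (by linarith)) ?_ ?_)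
    · rcases hgood with hzero | hlt
      · rw [hzero, zero_div]
        linarith [hhalf (2 * k) (by linarith)]
      · exact le_sideProb_of_lt_threshold (hhalf _ (by linarith)) (by linarith) (by linarith)
          (by linarith)
    · rw [mul_div_cancel₀ _ two_ne_zero]
      exact hZ.le_sideProb_threshold hp hc.le (by linarith) (hhalf _ (by linarith))

end RSW

end Voronoi

theorem theorem4p1 {Ω : Type*} [MeasurableSpace Ω] (μ : Measure Ω) [IsProbabilityMeasure μ]
    (Zb Zw : Ω → Set Voronoi.Plane) (p ρ : ℝ) (hp0 : 0 < p) (hp1 : p < 1) (hρ : 1 < ρ)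
    (hZ : Voronoi.IsColouredPoisson μ Zb Zw p)
    (hsquare : 0 < liminf (fun s : ℝ => Voronoi.crossingProb μ Zb Zw 1 s) atTop) :
    0 < limsup (fun s : ℝ => Voronoi.crossingProb μ Zb Zw ρ s) atTop := by
  obtain ⟨c, hc0, hc⟩ := exists_between hsquare
  have hctop : c ≠ ∞ := by
    rintro rfl
    exact not_top_lt hc
  have hcr : 0 < c.toReal := ENNReal.toReal_pos hc0.ne' hctop
  obtain ⟨s₁, hs₁⟩ := eventually_atTop.1 (eventually_lt_of_lt_liminf hc)
  have hsq : ∀ s ≥ max 1 s₁, c.toReal ≤ Voronoi.crossProb μ Zb Zw s s := by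
    intro s hs
    have hs1 : 1 ≤ s := (le_max_left _ _).trans hs
    have h := hs₁ s ((le_max_right _ _).trans hs)
    rw [hZ.crossingProb_eq (by rw [one_mul]; linarith), one_mul] at h
    exact ENNReal.toReal_le_of_le_ofReal (Voronoi.connProb_nonneg _ _ _) h.le
  obtain ⟨m, hm, hlong⟩ := hZ.exists_crossProb_ge hp0 hcr hsq
  -- enough overlapping rectangles of ratio `4 : 3` to make one of ratio `ρ`
  obtain ⟨n, hn⟩ := exists_nat_ge (3 * (ρ - 1))
  have hpos : 0 < c.toReal * (m * c.toReal) ^ n := by positivity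
  refine lt_of_lt_of_le (ENNReal.ofReal_pos.2 hpos) (le_limsup_of_frequently_le ?_)
  refine frequently_atTop.2 fun N => ?_
  obtain ⟨s, hsN, hs⟩ := hlong (max N (max 1 s₁))
  have hs1 : max 1 s₁ ≤ s := (le_max_right _ _).trans hsN
  have hs0 : 1 ≤ s := (le_max_left _ _).trans hs1
  refine ⟨s, (le_max_left _ _).trans hsN, ?_⟩
  have hρs : 0 < ρ * s := by nlinarith
  rw [hZ.crossingProb_eq hρs.ne']
  refine ENNReal.ofReal_le_ofReal ((hZ.crossProb_iterate_ge hp0 hcr.le hm.le (hsq s hs1)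
    (by linarith) hs n).trans (Voronoi.crossProb_anti hρs.le ?_ s))
  nlinarith
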